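/- Let $F$ be a dyadic local field, i.e. a nonarchimedean local field with $\operatorname{char} F\neq 2$, ring of integers $\mathfrak o$ and maximal ideal $\mathfrak p$, such that $2\in\mathfrak p$. Let $V$ be a $2$-dimensional $F$-vector space, let $H\cong \operatorname{End}_F(V)$ be a split quaternion algebra over $F$, and let $\ddagger$ be an orthogonal involution on $H$, i.e. an $F$-linear map with $(xy)^\ddagger=y^\ddagger x^\ddagger$, $(x^\ddagger)^\ddagger=x$, $\dim\{x: x^\ddagger=x\}=3$ and $\dim\{x:x^\ddagger=-x\}=1$. Notation. - $\operatorname{disc}(\ddagger)=\operatorname{nrd}(h)(F^\times)^2\subset F^\times$, where $h\neq 0$ is any element with $h^\ddagger=-h$; $\iota(\operatorname{disc}(\ddagger))$ is the ideal of $\mathfrak o$ generated by $\operatorname{disc}(\ddagger)\cap\mathfrak o$. - The quadratic defect of $\xi\in F$ is $\mathfrak d(\xi)=\bigcap\{\alpha\mathfrak o : \xi-\alpha \text{ is a square in } F\}$, and for $S\subset F$, $\mathfrak d(S)=\sum_{\xi\in S}\mathfrak d(\xi)$. - A $\ddagger$-order is an $\mathfrak o$-order $\mathcal O\subset H$ with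 $\mathcal O^\ddagger=\mathcal O$; a maximal $\ddagger$-order is a $\ddagger$-order not properly contained in another one. - $\operatorname{disc}(\mathcal O)$ is the reduced discriminant: the ideal whose square is generated by all $\det(\operatorname{trd}(x_ix_j))_{1\le i,j\le 4}$ with $x_1,\dots,x_4\in\mathcal O$. $\operatorname{disc}(H)$ is $\mathfrak p$ if $H$ is a division algebra and $\mathfrak o$ otherwise (so it is $\mathfrak o$ here). - A form associated with $\ddagger$ is a nondegenerate symmetric bilinear form $b$ on $V$ with $b(v,\sigma w)=b(\sigma^\ddagger v,w)$ for all $v,w\in V$, $\sigma\in H$. For a lattice $\Lambda\subset V$ (a finitely generated $\mathfrak o$-submodule that spans $V$ over $F$) put $\Lambda^\sharp=\{v\in V: b(v,\Lambda)\subset\mathfrak o\}$, $\operatorname{End}(\Lambda)=\{\sigma\in H:\sigma\Lambda\subset\Lambda\}$, and let $\mathfrak n\Lambda$ be the $\mathfrak o$-module generated by all $b(v,v)$, $v\in\Lambda$. For a nonzero fractional ideal $\mathfrak a$, $\Lambda$ is $\mathfrak a$-maximal if $\mathfrak n\Lambda\subset\mathfrak a$ and no lattice $\Lambda'\supsetneq\Lambda$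 satisfies $\mathfrak n\Lambda'\subset\mathfrak a$. Theorem. Assume $\mathfrak d\bigl(-\operatorname{disc}(\ddagger)\cap\mathfrak o\bigr)=\mathfrak p$. Then: 1. A form $b$ associated with $\ddagger$ exists, and for every such $b$ and every maximal $\ddagger$-order $\mathcal O$ of $H$ there are a nonzero fractional ideal $\mathfrak a$ of $F$ and an $\mathfrak a$-maximal lattice $\Lambda\subset V$ with $$\mathcal O=\operatorname{End}(\Lambda)\cap\operatorname{End}(\Lambda^\sharp).$$ 2. Any two maximal $\ddagger$-orders $\mathcal O,\mathcal O'$ of $H$ are isomorphic: there is an $F$-algebra automorphism $\varphi$ of $H$ with $\varphi(x^\ddagger)=\varphi(x)^\ddagger$ for all $x\in H$ and $\varphi(\mathcal O)=\mathcal O'$. 3. Every maximal $\ddagger$-order $\mathcal O$ satisfies $\operatorname{disc}(\mathcal O)=\operatorname{disc}(H)\cap\iota(\operatorname{disc}(\ddagger))$. -/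

import Mathlib

open scoped ValuativeRel

namespace QuatInvolution

/-! ### Quaternion algebras with involution over a field of characteristic not two -/

section Algebra

variable (F : Type*) {H : Type*} [Field F] [Ring H] [Algebra F H]

/-- The reduced trace of a quaternion algebra `H` (dimension four, `char F ≠ 2`): half of the
trace of left multiplication. -/
noncomputable def reducedTrace (x : H) : F :=
  LinearMap.trace F H (LinearMap.mulLeft F x) / 2

/-- Quaternion conjugation: `trd(x) - x`. -/
noncomputable def conj (x : H) : H := algebraMap F H (reducedTrace F x) - x

variable {F}

/-- An orthogonal involution of a quaternion algebra: an `F`-linear anti-automorphism of order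
dividing two whose symmetric elements form a space of dimension three, and whose skew-symmetric
elements form a space of dimension one. -/
structure IsOrthogonalInvolution (inv : H →ₗ[F] H) : Prop where
  map_mul : ∀ x y : H, inv (x * y) = inv y * inv x
  involutive : ∀ x : H, inv (inv x) = x
  finrank_symm : Module.finrank F (LinearMap.ker (inv - LinearMap.id)) = 3
  finrank_skew : Module.finrank F (LinearMap.ker (inv + LinearMap.id)) = 1

/-- The discriminant of an orthogonal involution, as a subset of `F` (a coset of the nonzero
squares): the classes `nrd(h) (Fˣ)²`, where `nrd(h) = conj h * h`, for nonzero `h` with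
`inv h = -h`. -/
def involutionDisc (inv : H →ₗ[F] H) : Set F :=
  {x | ∃ h : H, h ≠ 0 ∧ inv h = -h ∧ ∃ c : F, c ≠ 0 ∧
    algebraMap F H x = algebraMap F H (c ^ 2) * (conj F h * h)}

end Algebra

/-! ### Ideals attached to square classes

Here `R` is the ring of integers of `F`; ideals of `R` are viewed as `R`-submodules of `F`, so that
`1 : Submodule R F` is `R` itself. -/

section Ideals

variable (R : Type*) {F : Type*} [CommRing R] [Field F] [Algebra R F]

/-- The ideal `ι(D)` generated by the integral elements of a square class `D`. (Over a discrete
valuation ring, this is the union of the ideals generated by the integral elements of `D`.) -/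
def iotaIdeal (D : Set F) : Submodule R F :=
  Submodule.span R (D ∩ Set.range (algebraMap R F))

/-- The quadratic defect of `ξ`: the intersection of all `α R`, where `ξ = η ^ 2 + α`. -/
def quadraticDefect (ξ : F) : Submodule R F :=
  ⨅ α ∈ {α : F | ∃ η : F, ξ = η ^ 2 + α}, Submodule.span R {α}

/-- The quadratic defect of a set: the ideal generated by the quadratic defects of its elements. -/
def quadraticDefectSet (S : Set F) : Submodule R F :=
  ⨆ ξ ∈ S, quadraticDefect R ξ

end Ideals

/-! ### Orders -/

section Orders

variable {R F H : Type*} [CommRing R] [Field F] [Algebra R F]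
  [Ring H] [Algebra F H] [Algebra R H] [IsScalarTower R F H]

/-- An `R`-order of `H`: a subring containing `R` that is a full `R`-lattice. -/
def IsOrder (O : Subalgebra R H) : Prop :=
  Submodule.IsLattice F (Subalgebra.toSubmodule O)

/-- An order `O` that is equal to its image under the involution. -/
def IsInvOrder (inv : H →ₗ[F] H) (O : Subalgebra R H) : Prop :=
  IsOrder (F := F) O ∧ inv '' (O : Set H) = (O : Set H)

/-- A maximal element, under inclusion, among the orders closed under the involution. -/
def IsMaximalInvOrder (inv : H →ₗ[F] H) (O : Subalgebra R H) : Prop :=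
  Maximal (IsInvOrder inv) O

variable (F)

/-- `I` is the (reduced) discriminant of the order `O`: the square of `I` is the ideal generated by
all `det (trd (x i * x j))` with `x 0, x 1, x 2, x 3` in `O`. -/
def HasDiscriminant (O : Subalgebra R H) (I : Submodule R F) : Prop :=
  I ^ 2 = Submodule.span R {d : F | ∃ x : Fin 4 → H, (∀ i, x i ∈ O) ∧
    d = (Matrix.of fun i j => reducedTrace F (x i * x j)).det}

variable (R H)

open Classical in
/-- The discriminant of a quaternion algebra `H` over a nonarchimedean local field `F` with ring of
integers `R`: the maximal ideal of `R` if `H` is a division algebra, and `R` otherwise. -/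
noncomputable def algebraDisc [IsLocalRing R] : Submodule R F :=
  if ∀ x : H, x ≠ 0 → IsUnit x then
    IsLocalization.coeSubmodule F (IsLocalRing.maximalIdeal R)
  else 1

end Orders

/-! ### Lattices in a quadratic plane -/

section Lattices

variable {R F H V : Type*} [CommRing R] [Field F] [Algebra R F]
  [Ring H] [Algebra F H] [Algebra R H] [IsScalarTower R F H]
  [AddCommGroup V] [Module F V] [Module R V] [IsScalarTower R F V]

/-- `b` is a nondegenerate symmetric bilinear form whose adjoint involution on `H ≅ End(V)` is
`inv`. -/
structure IsFormOf (e : H ≃ₐ[F] Module.End F V) (inv : H →ₗ[F] H)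
    (b : LinearMap.BilinForm F V) : Prop where
  symm : ∀ v w : V, b v w = b w v
  nondegenerate : b.Nondegenerate
  adjoint : ∀ (x : H) (v w : V), b v (e x w) = b (e (inv x) v) w

/-- The norm of a lattice: the `R`-module generated by the values `b v v`, for `v` in `L`. (Over a
discrete valuation ring, this is the union of the modules `b v v R`.) -/
def latticeNorm (b : LinearMap.BilinForm F V) (L : Submodule R V) : Submodule R F :=
  Submodule.span R {x : F | ∃ v ∈ L, x = b v v}

/-- `L` is an `𝔞`-maximal lattice. -/
def IsMaximalLattice (b : LinearMap.BilinForm F V) (𝔞 : Submodule R F) (L : Submodule R V) :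
    Prop :=
  Submodule.IsLattice F L ∧ latticeNorm b L ≤ 𝔞 ∧
    ∀ L' : Submodule R V, Submodule.IsLattice F L' → L ≤ L' → latticeNorm b L' ≤ 𝔞 → L = L'

/-- `End(L)`, as a subring of `H ≅ End(V)`: the elements that map `L` into itself. -/
def endOrder (e : H ≃ₐ[F] Module.End F V) (L : Submodule R V) : Subalgebra R H where
  carrier := {x | ∀ v ∈ L, e x v ∈ L}
  mul_mem' := by
    intro x y hx hy v hv
    rw [_root_.map_mul]
    exact hx _ (hy v hv)
  add_mem' := by
    intro x y hx hy v hv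
    rw [map_add]
    exact L.add_mem (hx v hv) (hy v hv)
  algebraMap_mem' := by
    intro r v hv
    rw [IsScalarTower.algebraMap_apply R F H, AlgEquiv.commutes, Module.algebraMap_end_apply,
      algebraMap_smul]
    exact L.smul_mem r hv

end Lattices

end QuatInvolution

open Module

set_option linter.unusedSectionVars false

/-! The defect hypothesis enters only through one consequence: `-disc` contains no element `s²(1 +
ϖ²r)` with `r` integral. This has two effects on an associated form `b`. Every lattice has an
orthogonal basis: a Gram matrix whose off-diagonal entry strictly dominates both diagonal ones has
determinant `-s²(1 + ϖ²r)`, and in all other cases Gram-Schmidt is integral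
(`IsFormOf.exists_orthogonal_basis`). And if `-ξ` lies in `disc` with `ξ` integral and `ϖ² ∤ ξ`,
then `x² - ξy² ≡ 0` mod `ϖ²` forces `ϖ ∣ x` and `ϖ ∣ y` (`isPrimitivelyAnisotropic_of_neg_mem`).

An order `O` with involution stabilizes a lattice `M` with `ϖM♯ ⊆ M ⊆ M♯`, namely a maximal one
among suitable stable integral lattices. On an orthogonal basis of `M` the form is `a(x² - ξy²)`,
and the bounds on `M` give `ϖ² ∤ ξ`. By anisotropy `M` is `aR`-maximal. In this basis `End(M) ∩
End(M♯)` is the ring of integral matrices with upper right entry in `ξR`. It is stable under the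
involution and contains `O`, so it equals `O` when `O` is maximal.

The matrix description of the order and the involution depends only on `ξ`, which anisotropy
determines up to unit squares. This gives the isomorphism of any two maximal orders, and the
discriminant `ξR = ι(disc)`. -/

namespace QuatInvolution

/-! ### Primitive anisotropy of `x² - ξy²` modulo `ϖ²` -/

section Anisotropic

variable {R : Type*} [CommRing R] {ϖ : R}

/-- The form `x ^ 2 - ξ * y ^ 2` represents no multiple of `ϖ ^ 2` primitively. -/
def IsPrimitivelyAnisotropic (ϖ ξ : R) : Prop :=
  ∀ x y : R, ϖ ^ 2 ∣ x ^ 2 - ξ * y ^ 2 → ϖ ∣ x ∧ ϖ ∣ y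

namespace IsPrimitivelyAnisotropic

variable {ξ : R}

lemma not_sq_dvd (h : IsPrimitivelyAnisotropic ϖ ξ) (hϖ : Irreducible ϖ) : ¬ ϖ ^ 2 ∣ ξ := by
  intro hd
  refine hϖ.not_isUnit (isUnit_of_dvd_one (h 0 1 ?_).2)
  simpa using hd

lemma ne_zero (h : IsPrimitivelyAnisotropic ϖ ξ) (hϖ : Irreducible ϖ) : ξ ≠ 0 := by
  rintro rfl
  exact h.not_sq_dvd hϖ (dvd_zero _)

end IsPrimitivelyAnisotropic

end Anisotropic

/-! ### Integrality forced by anisotropy over the fraction field -/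

section DVR

variable {R F : Type*} [CommRing R] [IsDomain R] [IsDiscreteValuationRing R] [Field F] [Algebra R F]
  [IsFractionRing R F] {ϖ : R}

lemma exists_inv_eq_of_notMem_range (hϖ : Irreducible ϖ) {x : F}
    (hx : x ∉ Set.range (algebraMap R F)) : ∃ r : R, x⁻¹ = algebraMap R F (ϖ * r) := by
  rcases ValuationRing.isInteger_or_isInteger R x with h | ⟨s, hs⟩
  · exact absurd h hx
  · have hsu : ¬ IsUnit s := by
      rintro ⟨u, rfl⟩
      refine hx ⟨((u⁻¹ : Rˣ) : R), ?_⟩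
      rw [← inv_inv x, ← hs]
      refine eq_inv_of_mul_eq_one_left ?_
      rw [← map_mul, Units.inv_mul, map_one]
    have hm : s ∈ IsLocalRing.maximalIdeal R := (IsLocalRing.mem_maximalIdeal s).mpr hsu
    rw [hϖ.maximalIdeal_eq, Ideal.mem_span_singleton] at hm
    obtain ⟨r, rfl⟩ := hm
    exact ⟨r, hs.symm⟩

/-- The two alternatives exclude each other: the second carries a factor `ϖ`. Two such strict
divisibilities later produce the `ϖ²` in `1 + ϖ²r`. -/
lemma exists_eq_mul_or (hϖ : Irreducible ϖ) (x : F) {y : F} (hy : y ≠ 0) :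
    (∃ r : R, x = algebraMap R F r * y) ∨ (∃ r : R, y = algebraMap R F (ϖ * r) * x) := by
  by_cases h : x / y ∈ Set.range (algebraMap R F)
  · obtain ⟨r, hr⟩ := h
    exact .inl ⟨r, by rw [hr, div_mul_cancel₀ _ hy]⟩
  · have hx : x ≠ 0 := by
      rintro rfl
      exact h ⟨0, by simp⟩
    obtain ⟨r, hr⟩ := exists_inv_eq_of_notMem_range hϖ h
    exact .inr ⟨r, by rw [← hr, inv_div, div_mul_cancel₀ _ hx]⟩

namespace IsPrimitivelyAnisotropic

variable {ξ ξ' : R}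

lemma mem_range_of_sq_sub (h : IsPrimitivelyAnisotropic ϖ ξ) (hϖ : Irreducible ϖ) {x y : F}
    (hxy : x ^ 2 - algebraMap R F ξ * y ^ 2 ∈ Set.range (algebraMap R F)) :
    x ∈ Set.range (algebraMap R F) ∧ y ∈ Set.range (algebraMap R F) := by
  obtain ⟨n, hn⟩ := hxy
  -- If the coordinate `z` of larger size is not integral, dividing both coordinates by it
  -- multiplies the value of the form by `z⁻² ∈ ϖ²R` and leaves one coordinate equal to `1`, against
  -- anisotropy.
  have key : ∀ (z : F) (s t : R), z ≠ 0 → z⁻¹ ∈ Set.range (fun r => algebraMap R F (ϖ * r)) →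
      x = algebraMap R F s * z → y = algebraMap R F t * z → ϖ ∣ s ∧ ϖ ∣ t := by
    rintro z s t hz ⟨r, hr⟩ rfl rfl
    refine h s t ⟨r ^ 2 * n, ?_⟩
    apply IsFractionRing.injective R F
    have : algebraMap R F (ϖ ^ 2 * (r ^ 2 * n)) = algebraMap R F (ϖ * r) ^ 2 * algebraMap R F n := by
      simp only [map_mul, map_pow]
      ring
    rw [this, hn]
    simp only at hr
    rw [hr]
    simp only [map_sub, map_mul, map_pow]
    field_simp
  have h1 : ¬ ϖ ∣ 1 := fun hd => hϖ.not_isUnit (isUnit_of_dvd_one hd)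
  have inR : ∀ {s : R} {z : F}, z ∈ Set.range (algebraMap R F) →
      algebraMap R F s * z ∈ Set.range (algebraMap R F) := by
    rintro s z ⟨r, rfl⟩
    exact ⟨s * r, map_mul _ _ _⟩
  by_cases hx : x = 0
  · subst hx
    refine ⟨⟨0, map_zero _⟩, ?_⟩
    by_contra hy
    obtain ⟨r, hr⟩ := exists_inv_eq_of_notMem_range hϖ hy
    have hy0 : y ≠ 0 := by
      rintro rfl
      exact hy ⟨0, map_zero _⟩
    exact h1 (key y 0 1 hy0 ⟨r, hr.symm⟩ (by simp) (by simp)).2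
  rcases exists_eq_mul_or (R := R) hϖ y hx with ⟨r, hr⟩ | ⟨r, hr⟩
  · by_cases hxR : x ∈ Set.range (algebraMap R F)
    · exact ⟨hxR, hr ▸ inR hxR⟩
    · obtain ⟨s, hs⟩ := exists_inv_eq_of_notMem_range hϖ hxR
      exact absurd (key x 1 r hx ⟨s, hs.symm⟩ (by simp) hr).1 h1
  · by_cases hyR : y ∈ Set.range (algebraMap R F)
    · exact ⟨hr ▸ inR hyR, hyR⟩
    · obtain ⟨s, hs⟩ := exists_inv_eq_of_notMem_range hϖ hyR
      have hy0 : y ≠ 0 := by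
        rintro rfl
        exact hyR ⟨0, map_zero _⟩
      exact absurd (key y (ϖ * r) 1 hy0 ⟨s, hs.symm⟩ hr (by simp)).2 h1

lemma mem_range_of_eq_sq_mul (h' : IsPrimitivelyAnisotropic ϖ ξ) (hϖ : Irreducible ϖ) {t : F}
    (ht : algebraMap R F ξ' = t ^ 2 * algebraMap R F ξ) : t ∈ Set.range (algebraMap R F) := by
  by_contra hn
  obtain ⟨r, hr⟩ := exists_inv_eq_of_notMem_range hϖ hn
  have ht0 : t ≠ 0 := by
    rintro rfl
    exact hn ⟨0, map_zero _⟩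
  refine h'.not_sq_dvd hϖ ⟨r ^ 2 * ξ', ?_⟩
  apply IsFractionRing.injective R F
  have : algebraMap R F (ϖ ^ 2 * (r ^ 2 * ξ')) =
      algebraMap R F (ϖ * r) ^ 2 * algebraMap R F ξ' := by
    simp only [map_mul, map_pow]
    ring
  rw [this, ← hr, ht]
  field_simp

/-- By symmetry both `t` and `t⁻¹` are integral. Thus a square class determines its anisotropic
representative up to unit squares. -/
lemma exists_unit_of_eq_sq_mul (h : IsPrimitivelyAnisotropic ϖ ξ)
    (h' : IsPrimitivelyAnisotropic ϖ ξ') (hϖ : Irreducible ϖ) {t : F}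
    (ht0 : t ≠ 0) (ht : algebraMap R F ξ' = t ^ 2 * algebraMap R F ξ) :
    ∃ u : Rˣ, t = algebraMap R F u := by
  obtain ⟨r, hr⟩ := h.mem_range_of_eq_sq_mul hϖ ht
  obtain ⟨s, hs⟩ := h'.mem_range_of_eq_sq_mul (ξ' := ξ) (t := t⁻¹) hϖ (by rw [ht]; field_simp)
  have hrs : r * s = 1 := by
    apply IsFractionRing.injective R F
    rw [map_mul, hr, hs, map_one, mul_inv_cancel₀ ht0]
  exact ⟨⟨r, s, hrs, by rw [mul_comm, hrs]⟩, hr.symm⟩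

end IsPrimitivelyAnisotropic

end DVR

/-! ### Existence of an associated form -/

section FormExists

variable {F H V : Type*} [Field F] [Ring H] [Algebra F H] [AddCommGroup V] [Module F V]

/-- The isomorphism `End V ≃ End V*` obtained by composing an anti-automorphism with the
transpose. -/
lemma exists_linearEquiv_dual_of_antiAut [FiniteDimensional F V] (e : H ≃ₐ[F] End F V)
    (inv : H →ₗ[F] H) (hmul : ∀ x y : H, inv (x * y) = inv y * inv x)
    (hinv : ∀ x : H, inv (inv x) = x) :
    ∃ T : V ≃ₗ[F] Dual F V, ∀ (x : H) (v w : V), T v (e x w) = T (e (inv x) v) w := by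
  have h1 : inv 1 = 1 := by
    have := hmul (inv 1) 1
    rw [mul_one, hinv, mul_one] at this
    exact this.symm
  -- Both the involution and the transpose reverse products, so the composite is an algebra
  -- homomorphism.
  let f : End F V →ₐ[F] End F (Dual F V) := AlgHom.ofLinearMap
    { toFun := fun x => (e (inv (e.symm x))).dualMap
      map_add' := fun x y => by simp [map_add]; ext; simp
      map_smul' := fun c x => by simp [map_smul]; ext; simp }
    (by simp [h1]; ext; simp)
    (by intro x y; simp [hmul]; ext; simp)
  have hf : Function.Injective f := by
    intro x y hxy
    apply e.symm.injective
    rw [← hinv (e.symm x), ← hinv (e.symm y)]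
    congr 1
    apply e.injective
    ext v
    rw [← sub_eq_zero]
    refine (Module.forall_dual_apply_eq_zero_iff F _).mp fun g => ?_
    have := LinearMap.congr_fun (LinearMap.congr_fun hxy g) v
    simpa [f, sub_eq_zero] using this
  have hfb : Function.Bijective f := by
    refine ⟨hf, fun y => ?_⟩
    let z : End F V := (evalEquiv F V).symm.toLinearMap ∘ₗ y.dualMap ∘ₗ (evalEquiv F V).toLinearMap
    refine ⟨e (inv (e.symm z)), ?_⟩
    ext g v
    have hz : evalEquiv F V (z v) = y.dualMap (evalEquiv F V v) := by simp [z]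
    have := LinearMap.congr_fun hz g
    simpa [f, hinv] using this
  -- Skolem-Noether: an isomorphism of endomorphism algebras is conjugation by a linear isomorphism
  -- `T`, which is the desired form.
  obtain ⟨T, hT⟩ := (AlgEquiv.ofBijective f hfb).eq_linearEquivConjAlgEquiv
  refine ⟨T, fun x v w => ?_⟩
  have h := congrArg (fun g => g (e (inv x)) (T v) w) hT
  simp [f, hinv] at h
  exact h

end FormExists

section FormExists

variable {F H V : Type*} [Field F] [Ring H] [Algebra F H] [AddCommGroup V] [Module F V]

lemma IsOrthogonalInvolution.skew_eq_smul {inv : H →ₗ[F] H} (hinv : IsOrthogonalInvolution inv)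
    {h : H} (h0 : h ≠ 0) (hs : inv h = -h) {x : H} (hx : inv x = -x) : ∃ c : F, x = c • h := by
  have hmem : ∀ y : H, inv y = -y → y ∈ LinearMap.ker (inv + LinearMap.id) := by
    intro y hy
    simp [hy]
  obtain ⟨c, hc⟩ := (finrank_eq_one_iff_of_nonzero'
    (⟨h, hmem h hs⟩ : LinearMap.ker (inv + LinearMap.id))
    (by simpa [Subtype.ext_iff] using h0)).mp hinv.finrank_skew ⟨x, hmem x hx⟩
  exact ⟨c, (congrArg Subtype.val hc).symm⟩

/-- A linear endomorphism commuting with all linear endomorphisms is a scalar. -/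
lemma exists_smul_of_commute_all (g : End F V) (hg : ∀ x : End F V, g * x = x * g) :
    ∃ c : F, g = algebraMap F (End F V) c := by
  have : g ∈ Subalgebra.center F (End F V) := by
    rw [Subalgebra.mem_center_iff]
    exact fun x => (hg x).symm
  rw [Algebra.IsCentral.center_eq_bot] at this
  obtain ⟨c, hc⟩ := Algebra.mem_bot.mp this
  exact ⟨c, hc.symm⟩

/-- Every orthogonal involution of `End V` is the adjoint involution of a nondegenerate symmetric
bilinear form. -/
theorem IsOrthogonalInvolution.exists_isFormOf (h2 : (2 : F) ≠ 0) (hV : finrank F V = 2)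
    (e : H ≃ₐ[F] End F V) {inv : H →ₗ[F] H} (hinv : IsOrthogonalInvolution inv) :
    ∃ b : LinearMap.BilinForm F V, IsFormOf e inv b := by
  have : FiniteDimensional F V := .of_finrank_pos (by omega)
  obtain ⟨T, hT⟩ := exists_linearEquiv_dual_of_antiAut e inv hinv.map_mul hinv.involutive
  let b : LinearMap.BilinForm F V := T.toLinearMap
  have hbT : ∀ v w, b v w = T v w := fun _ _ => rfl
  have hadj : ∀ (x : H) (v w : V), b v (e x w) = b (e (inv x) v) w := hT
  -- `g` measures the asymmetry of `b`. Since adjunction twice is the identity, `g` commutes with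
  -- every endomorphism, hence is a scalar `c`, and `c² = 1`.
  let g : End F V := T.symm.toLinearMap ∘ₗ b.flip
  have hg : ∀ v w, b (g v) w = b w v := by
    intro v w
    simp [hbT, g]
  have hb : ∀ v v', (∀ w, b v w = b v' w) → v = v' := fun v v' h =>
    T.injective (LinearMap.ext h)
  obtain ⟨c, hc⟩ : ∃ c : F, g = algebraMap F (End F V) c := by
    refine exists_smul_of_commute_all g fun x => ?_
    obtain ⟨x, rfl⟩ := e.surjective x
    ext v
    refine hb _ _ fun w => ?_
    have h1 : b (e x (g v)) w = b (g v) (e (inv x) w) := by rw [hadj, hinv.involutive]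
    rw [End.mul_apply, End.mul_apply, h1, hg, hg, hadj]
  have hflip : ∀ v w, b w v = c * b v w := by
    intro v w
    rw [← hg, hc]
    simp
  have : Nontrivial V := Module.nontrivial_of_finrank_pos (R := F) (by omega)
  obtain ⟨v₀, hv₀⟩ := exists_ne (0 : V)
  obtain ⟨v₁, hv₁⟩ : ∃ w, b v₀ w ≠ 0 := by
    by_contra! h
    exact hv₀ (hb v₀ 0 fun w => by simp [h w])
  have hc2 : c * c = 1 := by
    have h1 := hflip v₀ v₁
    rw [hflip v₁ v₀] at h1
    have : (c * c - 1) * b v₁ v₀ = 0 := by linear_combination -h1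
    rcases mul_eq_zero.mp this with h | h
    · linear_combination h
    · rw [hflip v₁ v₀, h, mul_zero] at hv₁
      exact absurd rfl hv₁
  have hc1 : c = 1 := by
    rcases mul_self_eq_one_iff.mp hc2 with h | h
    · exact h
    exfalso
    -- If `c = -1`, the form is alternating and every rank-one operator `w ↦ b(u, w)u` is skew.
    -- Those for `u = v₀` and `u = v₁` are not proportional, but the skew elements form a line.
    have halt : ∀ v, b v v = 0 := by
      intro v
      have := hflip v v
      rw [h] at this
      have : 2 * b v v = 0 := by linear_combination this
      exact (mul_eq_zero.mp this).resolve_left h2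
    have hsk : ∀ u, inv (e.symm ((b u).smulRight u)) = -e.symm ((b u).smulRight u) := by
      intro u
      apply e.injective
      ext v
      refine hb _ _ fun w => ?_
      rw [← hadj]
      simp [hflip u v, h]
      ring
    have hx : e.symm ((b v₀).smulRight v₀) ≠ 0 := by
      intro h0
      have := LinearMap.congr_fun ((EmbeddingLike.map_eq_zero_iff (f := e.symm)).mp h0) v₁
      simp [hv₁, hv₀] at this
    obtain ⟨d, hd⟩ := hinv.skew_eq_smul hx (hsk v₀) (hsk v₁)
    rw [← map_smul] at hd
    have := LinearMap.congr_fun (e.symm.injective hd) v₀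
    simp [halt, hflip v₀ v₁, h, hv₁] at this
    rw [this] at hv₁
    simp at hv₁
  refine ⟨b, ⟨fun v w => by rw [hflip w v, hc1, one_mul], ?_, hadj⟩⟩
  rw [LinearMap.BilinForm.nondegenerate_iff_ker_eq_bot]
  exact T.ker

end FormExists

/-! ### The discriminant as a Gram determinant -/

section Disc

variable {F H V : Type*} [Field F] [Ring H] [Algebra F H] [AddCommGroup V] [Module F V]

/-- The matrix of an element of `H ≃ End V` in a basis of `V`. -/
noncomputable def matrixEquiv (e : H ≃ₐ[F] End F V) (v : Basis (Fin 2) F V) :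
    H ≃ₐ[F] Matrix (Fin 2) (Fin 2) F :=
  e.trans (LinearMap.toMatrixAlgEquiv v)

variable (e : H ≃ₐ[F] End F V) (v : Basis (Fin 2) F V)

lemma matrixEquiv_apply (x : H) (i j : Fin 2) : matrixEquiv e v x i j = v.repr (e x (v j)) i := by
  simp [matrixEquiv, LinearMap.toMatrixAlgEquiv_apply]

lemma apply_basis_eq (x : H) (j : Fin 2) :
    e x (v j) = matrixEquiv e v x 0 j • v 0 + matrixEquiv e v x 1 j • v 1 := by
  rw [matrixEquiv_apply, matrixEquiv_apply, ← Fin.sum_univ_two (fun i => v.repr (e x (v j)) i • v i),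
    v.sum_repr]

/-- Left multiplication on 2×2 matrices acts on the two columns separately, so its trace is twice
the matrix trace. -/
lemma reducedTrace_eq (h2 : (2 : F) ≠ 0) (x : H) :
    reducedTrace F x = matrixEquiv e v x 0 0 + matrixEquiv e v x 1 1 := by
  have h : LinearMap.trace F H (LinearMap.mulLeft F x) =
      2 * (matrixEquiv e v x 0 0 + matrixEquiv e v x 1 1) := by
    let B : Basis (Fin 2 × Fin 2) F H :=
      (Matrix.stdBasis F (Fin 2) (Fin 2)).map (matrixEquiv e v).symm.toLinearEquiv
    rw [LinearMap.trace_eq_matrix_trace F B, Matrix.trace, Fintype.sum_prod_type]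
    simp only [Matrix.diag_apply, LinearMap.toMatrix_apply, B, Basis.map_apply, Basis.map_repr,
      Matrix.stdBasis_eq_single]
    simp [Matrix.stdBasis, Matrix.mul_apply, Matrix.single_apply]
    ring
  rw [reducedTrace, h]
  field_simp

lemma IsFormOf.gram_det_ne_zero {e} {inv : H →ₗ[F] H} {b : LinearMap.BilinForm F V}
    (hb : IsFormOf e inv b) : b (v 0) (v 0) * b (v 1) (v 1) - b (v 0) (v 1) ^ 2 ≠ 0 := by
  have := (LinearMap.BilinForm.nondegenerate_iff_det_ne_zero v).mp hb.nondegenerate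
  rw [Matrix.det_fin_two] at this
  simp only [LinearMap.BilinForm.toMatrix_apply, hb.symm (v 1) (v 0)] at this
  rwa [pow_two]

/-- The discriminant of an orthogonal involution is the determinant of any Gram matrix of an
associated form. -/
theorem IsFormOf.mem_involutionDisc_iff (h2 : (2 : F) ≠ 0) {e} {inv : H →ₗ[F] H}
    (hinv : IsOrthogonalInvolution inv) {b : LinearMap.BilinForm F V} (hb : IsFormOf e inv b)
    {x : F} : x ∈ involutionDisc inv ↔
      ∃ c : F, c ≠ 0 ∧ x = c ^ 2 * (b (v 0) (v 0) * b (v 1) (v 1) - b (v 0) (v 1) ^ 2) := by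
  have hD := hb.gram_det_ne_zero v
  set D := b (v 0) (v 0) * b (v 1) (v 1) - b (v 0) (v 1) ^ 2 with hDdef
  -- With Gram matrix `G` and `J = !![0, 1; -1, 0]`, this is `J * G`. It is skew because `G * J * G`
  -- is antisymmetric. It has trace zero and square `-D`, so its reduced norm is `D`.
  let A : Matrix (Fin 2) (Fin 2) F :=
    !![b (v 0) (v 1), b (v 1) (v 1); -b (v 0) (v 0), -b (v 0) (v 1)]
  let h : H := (matrixEquiv e v).symm A
  have hA : matrixEquiv e v h = A := (matrixEquiv e v).apply_symm_apply A
  have hsq : A * A = algebraMap F _ (-D) := by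
    ext i j
    fin_cases i <;> fin_cases j <;>
      simp [A, Matrix.mul_apply, Fin.sum_univ_two, Matrix.algebraMap_matrix_apply, hDdef] <;> ring
  have h0 : h ≠ 0 := by
    intro h0
    have : A = 0 := by rw [← hA, h0, map_zero]
    rw [this, mul_zero] at hsq
    have := congrFun (congrFun hsq 0) 0
    simp [Matrix.algebraMap_matrix_apply] at this
    exact hD this
  have hskew : inv h = -h := by
    apply e.injective
    have hnd : ∀ u : V, (∀ w, b u w = 0) → u = 0 := fun u hu => hb.nondegenerate.1 u hu
    have key : ∀ i j, b (e (inv h) (v i)) (v j) = b (e (-h) (v i)) (v j) := by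
      intro i j
      rw [← hb.adjoint, map_neg, LinearMap.neg_apply, apply_basis_eq e v, apply_basis_eq e v, hA]
      fin_cases i <;> fin_cases j <;> simp [A, hb.symm (v 1) (v 0)] <;> ring
    refine v.ext fun i => ?_
    rw [← sub_eq_zero]
    refine hnd _ fun w => ?_
    rw [map_sub, LinearMap.sub_apply, sub_eq_zero]
    exact LinearMap.congr_fun (v.ext (key i)) w
  have hconj : conj F h * h = algebraMap F H D := by
    have : reducedTrace F h = 0 := by
      rw [reducedTrace_eq e v h2, hA]
      simp [A]
    apply (matrixEquiv e v).injective
    rw [conj, this, map_zero, zero_sub, neg_mul, map_neg, map_mul, hA, hsq, AlgEquiv.commutes,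
      map_neg, neg_neg]
  have hconj' : ∀ t : F, conj F (t • h) * (t • h) = algebraMap F H (t ^ 2 * D) := by
    intro t
    have : conj F (t • h) = t • conj F h := by
      rw [conj, conj, reducedTrace_eq e v h2, reducedTrace_eq e v h2, map_smul, smul_sub,
        Matrix.smul_apply, Matrix.smul_apply, smul_eq_mul, smul_eq_mul, ← mul_add, map_mul,
        ← Algebra.smul_def]
    rw [this, smul_mul_smul_comm, hconj, map_mul, Algebra.smul_def, pow_two]
  have : Nontrivial H := ⟨h, 0, h0⟩
  have hinj := FaithfulSMul.algebraMap_injective F H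
  constructor
  · rintro ⟨k, hk0, hk, c, hc, hx⟩
    obtain ⟨t, rfl⟩ := hinv.skew_eq_smul h0 hskew hk
    refine ⟨c * t, mul_ne_zero hc (fun ht => hk0 (by rw [ht, zero_smul])), hinj ?_⟩
    rw [hx, hconj', ← map_mul]
    ring_nf
  · rintro ⟨c, hc, rfl⟩
    exact ⟨h, h0, hskew, c, hc, by rw [hconj, map_mul]⟩

end Disc

/-! ### What the quadratic defect hypothesis gives -/

section Defect

variable {R F : Type*} [CommRing R] [IsDomain R] [IsDiscreteValuationRing R] [Field F] [Algebra R F]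
  [IsFractionRing R F] {ϖ : R}

lemma isUnit_of_not_dvd (hϖ : Irreducible ϖ) {x : R} (hx : ¬ ϖ ∣ x) : IsUnit x := by
  by_contra h
  have hm : x ∈ IsLocalRing.maximalIdeal R := (IsLocalRing.mem_maximalIdeal x).mpr h
  rw [hϖ.maximalIdeal_eq, Ideal.mem_span_singleton] at hm
  exact hx hm

/-- If the quadratic defect of `-D ∩ R` is the maximal ideal, then `-D` contains no square multiple
of an element congruent to `1` modulo the square of the maximal ideal. -/
lemma notMem_of_quadraticDefectSet_eq (hϖ : Irreducible ϖ) {D : Set F}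
    (hD : ∀ x ∈ D, ∀ y ∈ D, ∃ t : F, x = t ^ 2 * y)
    (hdef : quadraticDefectSet R ({ξ : F | -ξ ∈ D} ∩ Set.range (algebraMap R F)) =
      IsLocalization.coeSubmodule F (IsLocalRing.maximalIdeal R)) (s : F) (r : R) :
    -(s ^ 2 * algebraMap R F (1 + ϖ ^ 2 * r)) ∉ D := by
  intro hs
  have hu : IsUnit (1 + ϖ ^ 2 * r) := by
    refine isUnit_of_not_dvd hϖ fun h => hϖ.not_isUnit (isUnit_of_dvd_one ?_)
    exact (dvd_add_left ⟨ϖ * r, by ring⟩).mp h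
  -- If `-D` contained such an element, every integral member of `-D` would be `q²(1 + ϖ²r)` with
  -- `q` integral, hence a square plus a multiple of `ϖ²`. The total defect would then lie in `ϖ²R`,
  -- not equal `ϖR`.
  have hle : quadraticDefectSet R ({ξ : F | -ξ ∈ D} ∩ Set.range (algebraMap R F)) ≤
      Submodule.span R {algebraMap R F (ϖ ^ 2)} := by
    refine iSup₂_le ?_
    rintro ξ ⟨hξ, n, hn⟩
    obtain ⟨t, ht⟩ := hD _ hξ _ hs
    have hξ' : ξ = (t * s) ^ 2 * algebraMap R F (1 + ϖ ^ 2 * r) := by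
      linear_combination -ht
    have hts : t * s ∈ Set.range (algebraMap R F) := by
      by_contra hn'
      obtain ⟨q, hq⟩ := exists_inv_eq_of_notMem_range hϖ hn'
      have h0 : t * s ≠ 0 := fun h => hn' ⟨0, by rw [h, map_zero]⟩
      refine hϖ.not_isUnit (isUnit_of_dvd_unit ⟨ϖ * q ^ 2 * n, ?_⟩ hu)
      apply IsFractionRing.injective R F
      have : algebraMap R F (ϖ * (ϖ * q ^ 2 * n)) =
          algebraMap R F (ϖ * q) ^ 2 * algebraMap R F n := by
        simp only [map_mul, map_pow]
        ring
      rw [this, hn, hξ', ← hq, ← mul_assoc, ← mul_pow, inv_mul_cancel₀ h0, one_pow, one_mul]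
    obtain ⟨q, hq⟩ := hts
    refine (iInf₂_le ((t * s) ^ 2 * algebraMap R F (ϖ ^ 2 * r))
      (show _ ∈ {α : F | ∃ η : F, ξ = η ^ 2 + α} from ⟨t * s, ?_⟩)).trans ?_
    · rw [hξ', map_add, map_one]
      ring
    · rw [Submodule.span_singleton_le_iff_mem, Submodule.mem_span_singleton]
      refine ⟨q ^ 2 * r, ?_⟩
      rw [Algebra.smul_def, ← hq]
      simp only [map_mul, map_pow]
      ring
  rw [hdef] at hle
  have hmem : algebraMap R F ϖ ∈ IsLocalization.coeSubmodule F (IsLocalRing.maximalIdeal R) :=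
    (IsLocalization.mem_coeSubmodule F _).mpr
      ⟨ϖ, by rw [hϖ.maximalIdeal_eq]; exact Ideal.mem_span_singleton_self ϖ, rfl⟩
  obtain ⟨c, hc⟩ := Submodule.mem_span_singleton.mp (hle hmem)
  rw [Algebra.smul_def, ← map_mul] at hc
  have hc' := IsFractionRing.injective R F hc
  refine hϖ.not_isUnit (isUnit_of_dvd_one ⟨c, ?_⟩)
  apply mul_left_cancel₀ hϖ.ne_zero
  linear_combination -hc'

/-- Suppose `y` is a unit. If `ϖ ∣ ξ`, then `ϖ ∣ x`, so `ϖ² ∣ ξ`. If `ξ` is a unit, so is `x`, and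
`ξ` is `(x/y)²` times an element of `1 + ϖ²R`. -/
lemma isPrimitivelyAnisotropic_of_neg_mem (hϖ : Irreducible ϖ) {D : Set F}
    (hN : ∀ (s : F) (r : R), -(s ^ 2 * algebraMap R F (1 + ϖ ^ 2 * r)) ∉ D)
    {ξ : R} (hξ : -algebraMap R F ξ ∈ D) (hsq : ¬ ϖ ^ 2 ∣ ξ) :
    IsPrimitivelyAnisotropic ϖ ξ := by
  have hp : Prime ϖ := hϖ.prime
  intro x y hxy
  have hx_of : ϖ ∣ ξ * y ^ 2 → ϖ ∣ x := fun h =>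
    hp.dvd_of_dvd_pow ((dvd_sub_left h).mp ((dvd_pow_self ϖ two_ne_zero).trans hxy))
  by_cases hy : ϖ ∣ y
  · exact ⟨hx_of ((hy.trans (dvd_pow_self y two_ne_zero)).mul_left ξ), hy⟩
  exfalso
  by_cases hd : ϖ ∣ ξ
  · have hx := hx_of (hd.mul_right _)
    have := (dvd_sub_right (pow_dvd_pow_of_dvd hx 2)).mp hxy
    exact hsq (hp.pow_dvd_of_dvd_mul_right 2 (fun h => hy (hp.dvd_of_dvd_pow h)) this)
  · have hx : ¬ ϖ ∣ x := by
      intro hx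
      have h1 : ϖ ∣ x ^ 2 - ξ * y ^ 2 := (dvd_pow_self ϖ two_ne_zero).trans hxy
      have h2 := (dvd_sub_right (hx.trans (dvd_pow_self x two_ne_zero))).mp h1
      rcases hp.dvd_or_dvd h2 with h | h
      · exact hd h
      · exact hy (hp.dvd_of_dvd_pow h)
    obtain ⟨u, rfl⟩ := isUnit_of_not_dvd hϖ hx
    obtain ⟨w, rfl⟩ := isUnit_of_not_dvd hϖ hy
    obtain ⟨c, hc⟩ := hxy
    -- Solving `u² - ξw² = ϖ²c` for `ξ` gives `(u/w)²(1 - ϖ²c/u²)`.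
    refine hN (algebraMap R F (u * (w⁻¹ : Rˣ))) (-(c * (u⁻¹ : Rˣ) ^ 2)) ?_
    rw [← map_pow, ← map_mul]
    convert hξ using 3
    have hu : (u : R) * (u⁻¹ : Rˣ) = 1 := Units.mul_inv u
    have hw : (w : R) * (w⁻¹ : Rˣ) = 1 := Units.mul_inv w
    generalize ((u⁻¹ : Rˣ) : R) = u' at *
    generalize ((w⁻¹ : Rˣ) : R) = w' at *
    linear_combination w' ^ 2 * hc - ϖ ^ 2 * c * w' ^ 2 * ((u : R) * u' + 1) * hu
      + ξ * ((w : R) * w' + 1) * hw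

end Defect

/-! ### Lattices stable under an order -/

section Lattice

variable {R F H V : Type*} [CommRing R] [IsDomain R] [IsDiscreteValuationRing R] [Field F]
  [Algebra R F] [IsFractionRing R F] {ϖ : R}
  [Ring H] [Algebra F H] [Algebra R H] [IsScalarTower R F H]
  [AddCommGroup V] [Module F V] [Module R V] [IsScalarTower R F V]

lemma isLattice_span_range (v : Basis (Fin 2) F V) :
    Submodule.IsLattice F (Submodule.span R (Set.range v)) where
  fg := Submodule.fg_span (Set.finite_range v)
  span_eq_top := by rw [Submodule.span_span_of_tower, v.span_eq]

lemma exists_basis_of_isLattice (hV : finrank F V = 2) (M : Submodule R V)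
    [Submodule.IsLattice F M] : ∃ v : Basis (Fin 2) F V, M = Submodule.span R (Set.range v) := by
  have : FiniteDimensional F V := .of_finrank_pos (by omega)
  have hr : finrank R M = 2 := by
    rw [← hV]
    exact Module.finrank_eq_of_rank_eq (by
      rw [Submodule.IsLattice.rank' F M, Module.finrank_eq_rank'])
  let w : Basis (Fin 2) R M := Module.finBasisOfFinrankEq R M hr
  refine ⟨w.extendOfIsLattice F, ?_⟩
  have : (⇑(w.extendOfIsLattice F) : Fin 2 → V) = M.subtype ∘ w := by
    ext i
    simp
  rw [this, Set.range_comp, ← Submodule.map_span, w.span_eq, Submodule.map_top,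
    Submodule.range_subtype]

lemma exists_basis_of_span_eq (v : Basis (Fin 2) F V) (w : Fin 2 → V)
    (h : Submodule.span R (Set.range w) = Submodule.span R (Set.range v)) :
    ∃ v' : Basis (Fin 2) F V, ⇑v' = w := by
  have htop : ⊤ ≤ Submodule.span F (Set.range w) := by
    rw [← Submodule.span_span_of_tower R, h, Submodule.span_span_of_tower, v.span_eq]
  have hc : Fintype.card (Fin 2) = finrank F V := (finrank_eq_card_basis v).symm
  exact ⟨basisOfTopLeSpanOfCardEqFinrank w htop hc, coe_basisOfTopLeSpanOfCardEqFinrank w htop hc⟩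

lemma mem_span_range_iff (v : Basis (Fin 2) F V) {x : V} :
    x ∈ Submodule.span R (Set.range v) ↔
      ∀ i, v.repr x i ∈ Set.range (algebraMap R F) :=
  v.mem_span_iff_repr_mem R x

lemma exists_smul_mem_span (u v : Basis (Fin 2) F V) : ∃ δ : R, δ ≠ 0 ∧
    ∀ x ∈ Submodule.span R (Set.range u), δ • x ∈ Submodule.span R (Set.range v) := by
  obtain ⟨δ, hδ⟩ := IsLocalization.exist_integer_multiples_of_finite (nonZeroDivisors R)
    (fun p : Fin 2 × Fin 2 => v.repr (u p.1) p.2)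
  refine ⟨δ, nonZeroDivisors.ne_zero δ.2, ?_⟩
  intro x hx
  induction hx using Submodule.span_induction with
  | mem x hx =>
    obtain ⟨i, rfl⟩ := hx
    rw [mem_span_range_iff]
    intro j
    obtain ⟨n, hn⟩ := hδ (i, j)
    refine ⟨n, ?_⟩
    rw [hn, ← algebraMap_smul F (δ : R) (u i), map_smul, Finsupp.smul_apply, algebraMap_smul]
  | zero => rw [smul_zero]; exact zero_mem _
  | add x y _ _ hx hy => rw [smul_add]; exact add_mem hx hy
  | smul a x _ hx => rw [smul_comm]; exact Submodule.smul_mem _ _ hx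

variable {e : H ≃ₐ[F] End F V} {inv : H →ₗ[F] H} {b : LinearMap.BilinForm F V}

lemma IsFormOf.exists_dualSubmodule_eq_span (hb : IsFormOf e inv b) (v : Basis (Fin 2) F V) :
    ∃ u : Basis (Fin 2) F V, b.dualSubmodule (Submodule.span R (Set.range v)) =
      Submodule.span R (Set.range u) :=
  ⟨b.dualBasis hb.nondegenerate v, b.dualSubmodule_span_of_basis hb.nondegenerate v⟩

/-- The lattice `O v₀ + O v₁` works. -/
lemma exists_stable_lattice (v : Basis (Fin 2) F V) {O : Subalgebra R H}
    (hO : IsOrder (F := F) O) : ∃ M : Submodule R V, Submodule.IsLattice F M ∧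
      ∀ x ∈ O, ∀ w ∈ M, e x w ∈ M := by
  let f : V → H →ₗ[R] V := fun w =>
    (LinearMap.applyₗ w ∘ₗ e.toLinearMap).restrictScalars R
  have hf : ∀ w x, f w x = e x w := fun _ _ => rfl
  let N : Fin 2 → Submodule R V := fun i => (Subalgebra.toSubmodule O).map (f (v i))
  have hN : ∀ i, ∀ x ∈ O, ∀ w ∈ N i, e x w ∈ N i := by
    rintro i x hx w ⟨y, hy, rfl⟩
    exact ⟨x * y, O.mul_mem hx hy, by simp [hf]⟩
  have hv : ∀ i, v i ∈ N i := fun i => ⟨1, O.one_mem, by simp [hf]⟩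
  refine ⟨⨆ i, N i, ⟨?_, ?_⟩, ?_⟩
  · exact Submodule.fg_iSup _ fun i => hO.fg.map _
  · rw [eq_top_iff, ← v.span_eq]
    refine Submodule.span_mono ?_
    rintro _ ⟨i, rfl⟩
    exact (le_iSup N i) (hv i)
  · intro x hx w hw
    induction hw using Submodule.iSup_induction' with
    | mem i w hw => exact (le_iSup N i) (hN i x hx w hw)
    | zero => rw [map_zero]; exact zero_mem _
    | add w z _ _ hw hz => rw [map_add]; exact add_mem hw hz

lemma IsFormOf.dualSubmodule_stable (hb : IsFormOf e inv b) {x : H} {M : Submodule R V}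
    (hinv : inv (inv x) = x)
    (hx : ∀ w ∈ M, e (inv x) w ∈ M) : ∀ w ∈ b.dualSubmodule M, e x w ∈ b.dualSubmodule M := by
  intro w hw y hy
  have := hb.adjoint (inv x) w y
  rw [hinv] at this
  rw [← this]
  exact hw _ (hx y hy)

/-- An integral lattice that is stable under a given order. -/
lemma IsFormOf.exists_stable_integral_lattice (hV : finrank F V = 2) (hb : IsFormOf e inv b)
    {O : Subalgebra R H} (hO : IsOrder (F := F) O) :
    ∃ M : Submodule R V, Submodule.IsLattice F M ∧ (∀ x ∈ O, ∀ w ∈ M, e x w ∈ M) ∧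
      M ≤ b.dualSubmodule M := by
  have : FiniteDimensional F V := .of_finrank_pos (by omega)
  obtain ⟨M, hM, hst⟩ := exists_stable_lattice (e := e) (finBasisOfFinrankEq F V hV) hO
  obtain ⟨v, rfl⟩ := exists_basis_of_isLattice hV M
  obtain ⟨u, hu⟩ := hb.exists_dualSubmodule_eq_span (R := R) v
  obtain ⟨δ, hδ, hδu⟩ := exists_smul_mem_span (R := R) v u
  have hδ' : algebraMap R F δ ≠ 0 := by
    rwa [Ne, FaithfulSMul.algebraMap_eq_zero_iff]
  rw [← hu] at hδu
  -- Since `δM ⊆ M♯`, the values of `b` on `δM` lie in `δR`.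
  refine ⟨(Submodule.span R (Set.range v)).map (LinearMap.lsmul R V δ), ⟨hM.fg.map _, ?_⟩, ?_, ?_⟩
  · rw [eq_top_iff, ← v.span_eq, Submodule.span_le]
    rintro _ ⟨i, rfl⟩
    have : v i = (algebraMap R F δ)⁻¹ • (δ • v i) := by
      rw [← algebraMap_smul F δ (v i), smul_smul, inv_mul_cancel₀ hδ', one_smul]
    rw [this]
    exact Submodule.smul_mem _ _ (Submodule.subset_span
      ⟨v i, Submodule.subset_span ⟨i, rfl⟩, rfl⟩)
  · rintro x hx _ ⟨w, hw, rfl⟩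
    refine ⟨e x w, hst x hx w hw, ?_⟩
    simp only [LinearMap.lsmul_apply]
    exact (LinearMap.map_smul_of_tower (e x) δ w).symm
  · rintro _ ⟨w, hw, rfl⟩ _ ⟨y, hy, rfl⟩
    simp only [LinearMap.lsmul_apply]
    rw [LinearMap.map_smul_of_tower]
    exact Submodule.smul_mem _ _ (hδu w hw y hy)

/-- An order with involution stabilizes a lattice `M` with `ϖ M♯ ⊆ M ⊆ M♯`. -/
lemma IsFormOf.exists_stable_almost_unimodular_lattice (hϖ : Irreducible ϖ)
    (hV : finrank F V = 2) (hinv : ∀ x, inv (inv x) = x) (hb : IsFormOf e inv b)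
    {O : Subalgebra R H} (hO : IsOrder (F := F) O) (hOinv : ∀ x ∈ O, inv x ∈ O) :
    ∃ M : Submodule R V, Submodule.IsLattice F M ∧ (∀ x ∈ O, ∀ w ∈ M, e x w ∈ M) ∧
      M ≤ b.dualSubmodule M ∧ ∀ w ∈ b.dualSubmodule M, ϖ • w ∈ M := by
  obtain ⟨M₀, hM₀, hst₀, hint₀⟩ := hb.exists_stable_integral_lattice hV hO
  have dual_anti : ∀ {M N : Submodule R V}, M ≤ N → b.dualSubmodule N ≤ b.dualSubmodule M :=
    fun h w hw y hy => hw y (h hy)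
  set D := b.dualSubmodule M₀ with hD
  have hDfg : D.FG := by
    obtain ⟨v, rfl⟩ := exists_basis_of_isLattice hV M₀
    obtain ⟨u, hu⟩ := hb.exists_dualSubmodule_eq_span (R := R) v
    rw [hD, hu]
    exact Submodule.fg_span (Set.finite_range u)
  have : IsNoetherian R D := isNoetherian_of_fg_of_noetherian D hDfg
  -- Integral lattices containing `M₀` lie in its dual `D`, a Noetherian module, so a maximal one
  -- among the stable ones exists.
  let P : Submodule R V → Prop := fun N =>
    M₀ ≤ N ∧ (∀ x ∈ O, ∀ w ∈ N, e x w ∈ N) ∧ N ≤ b.dualSubmodule N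
  have hPD : ∀ N, P N → N ≤ D := fun N hN => hN.2.2.trans (dual_anti hN.1)
  obtain ⟨M, hM, hmax⟩ : ∃ M, P M ∧ ∀ N, P N → M ≤ N → N ≤ M := by
    have hmc : ∀ N, P N → (N.comap D.subtype).map D.subtype = N := by
      intro N hN
      rw [Submodule.map_comap_subtype, inf_eq_right.mpr (hPD N hN)]
    obtain ⟨M', hM', hmax'⟩ := (wellFounded_gt (α := Submodule R D)).has_min
      {N' | P (N'.map D.subtype)} ⟨M₀.comap D.subtype, by
        have h : P M₀ := ⟨le_rfl, hst₀, hint₀⟩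
        simpa only [Set.mem_ofPred_eq, hmc M₀ h] using h⟩
    refine ⟨M'.map D.subtype, hM', fun N hN hle => ?_⟩
    have h1 : M' ≤ N.comap D.subtype := Submodule.map_le_iff_le_comap.mp hle
    have h2 := hmax' (N.comap D.subtype) (by simpa only [Set.mem_ofPred_eq, hmc N hN] using hN)
    have h3 : M' = N.comap D.subtype := by
      by_contra hne
      exact h2 (lt_of_le_of_ne h1 hne)
    rw [h3, hmc N hN]
  obtain ⟨hM₀M, hst, hint⟩ := hM
  have hMlat : Submodule.IsLattice F M :=
    Submodule.IsLattice.of_le_of_isLattice_of_fg F hM₀M (by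
      rw [← inf_eq_right.mpr (hPD M ⟨hM₀M, hst, hint⟩), ← Submodule.map_comap_subtype]
      exact (IsNoetherian.noetherian _).map _)
  have hstd : ∀ x ∈ O, ∀ w ∈ b.dualSubmodule M, e x w ∈ b.dualSubmodule M := fun x hx =>
    hb.dualSubmodule_stable (hinv x) (hst _ (hOinv x hx))
  have step : ∀ k : ℕ, (∀ w ∈ b.dualSubmodule M, ϖ ^ (k + 1) • w ∈ M) →
      ∀ w ∈ b.dualSubmodule M, ϖ • w ∈ M := by
    intro k
    induction k with
    | zero => simp
    | succ k ih =>
      intro hk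
      refine ih fun w hw => ?_
      -- With `ϖ^(k+2) M♯ ⊆ M`, the lattice `M + ϖ^(k+1) M♯` is still integral because `b(ϖ^(k+1)d,
      -- ϖ^(k+1)d') = ϖ^k b(d, ϖ^(k+2)d')`. Maximality of `M` then lowers the exponent by one.
      let N : Submodule R V := M ⊔ (b.dualSubmodule M).map (LinearMap.lsmul R V (ϖ ^ (k + 1)))
      have hN : P N := by
        refine ⟨hM₀M.trans le_sup_left, ?_, ?_⟩
        · intro x hx w hw
          obtain ⟨m, hm, _, ⟨d, hd, rfl⟩, rfl⟩ := Submodule.mem_sup.mp hw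
          rw [map_add]
          refine add_mem (Submodule.mem_sup_left (hst x hx m hm))
            (Submodule.mem_sup_right ⟨e x d, hstd x hx d hd, ?_⟩)
          simp only [LinearMap.lsmul_apply]
          exact (LinearMap.map_smul_of_tower (e x) _ d).symm
        · intro w hw y hy
          obtain ⟨m, hm, _, ⟨d, hd, rfl⟩, rfl⟩ := Submodule.mem_sup.mp hw
          obtain ⟨m', hm', _, ⟨d', hd', rfl⟩, rfl⟩ := Submodule.mem_sup.mp hy
          simp only [LinearMap.lsmul_apply, map_add, LinearMap.add_apply]
          refine add_mem (add_mem (hint hm m' hm') ?_) (add_mem ?_ ?_)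
          · rw [LinearMap.map_smul_of_tower, LinearMap.smul_apply]
            exact Submodule.smul_mem _ _ (hd m' hm')
          · rw [LinearMap.map_smul_of_tower, hb.symm]
            exact Submodule.smul_mem _ _ (hd' m hm)
          · have h1 : b (ϖ ^ (k + 1) • d) (ϖ ^ (k + 1) • d') =
                ϖ ^ k • b d (ϖ ^ (k + 1 + 1) • d') := by
              simp only [LinearMap.map_smul_of_tower, LinearMap.smul_apply, smul_smul]
              congr 1
              ring
            rw [h1]
            exact Submodule.smul_mem _ _ (hd _ (hk d' hd'))
      exact hmax N hN le_sup_left (Submodule.mem_sup_right ⟨w, hw, rfl⟩)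
  refine ⟨M, hMlat, hst, hint, ?_⟩
  obtain ⟨v, hv⟩ := exists_basis_of_isLattice hV M
  obtain ⟨u, hu⟩ := hb.exists_dualSubmodule_eq_span (R := R) v
  obtain ⟨δ, hδ, hδu⟩ := exists_smul_mem_span (R := R) u v
  rw [← hu, ← hv] at hδu
  -- Here `ϖ^n` already carries the dual into `M`; the spare factor `ϖ` lets the descent stop at
  -- exponent one even when `n = 0`.
  obtain ⟨n, ⟨ε, hε⟩⟩ := IsDiscreteValuationRing.associated_pow_irreducible hδ hϖ
  refine step n fun w hw => ?_
  rw [pow_succ', ← hε, mul_smul, mul_comm, mul_smul]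
  exact M.smul_mem _ (M.smul_mem _ (hδu w hw))

end Lattice

/-! ### Adapted bases: maximality, dual and involution in coordinates -/

section Adapted

variable {R F H V : Type*} [CommRing R] [IsDomain R] [IsDiscreteValuationRing R] [Field F]
  [Algebra R F] [IsFractionRing R F] {ϖ ξ : R}
  [Ring H] [Algebra F H] [Algebra R H] [IsScalarTower R F H]
  [AddCommGroup V] [Module F V] [Module R V] [IsScalarTower R F V]
  {e : H ≃ₐ[F] End F V} {inv : H →ₗ[F] H} {b : LinearMap.BilinForm F V}

/-- An orthogonal basis in which the form is a multiple of `x ^ 2 - ξ * y ^ 2`, where the latter is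
primitively anisotropic. -/
structure IsAdaptedBasis (b : LinearMap.BilinForm F V) (ϖ ξ : R) (v : Basis (Fin 2) F V) :
    Prop where
  ortho : b (v 0) (v 1) = 0
  ne_zero : b (v 0) (v 0) ≠ 0
  apply_one : b (v 1) (v 1) = -(algebraMap R F ξ * b (v 0) (v 0))
  aniso : IsPrimitivelyAnisotropic ϖ ξ

lemma eq_repr_smul_add (v : Basis (Fin 2) F V) (w : V) :
    w = v.repr w 0 • v 0 + v.repr w 1 • v 1 := by
  rw [← Fin.sum_univ_two (fun i => v.repr w i • v i), v.sum_repr]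

lemma span_range_swap (v : Basis (Fin 2) F V) :
    Submodule.span R (Set.range (v.reindex (Equiv.swap 0 1))) = Submodule.span R (Set.range v) := by
  rw [Basis.range_reindex]

lemma span_pair_sub_smul (x y : V) (r : R) :
    Submodule.span R (Set.range ![x, y - r • x]) = Submodule.span R (Set.range ![x, y]) := by
  apply le_antisymm <;> rw [Submodule.span_le] <;> rintro _ ⟨i, rfl⟩
  · have h0 : x ∈ Submodule.span R (Set.range ![x, y]) := Submodule.subset_span ⟨0, rfl⟩
    have h1 : y ∈ Submodule.span R (Set.range ![x, y]) := Submodule.subset_span ⟨1, rfl⟩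
    fin_cases i
    · exact h0
    · exact sub_mem h1 (Submodule.smul_mem _ _ h0)
  · have h0 : x ∈ Submodule.span R (Set.range ![x, y - r • x]) := Submodule.subset_span ⟨0, rfl⟩
    have h1 : y - r • x ∈ Submodule.span R (Set.range ![x, y - r • x]) :=
      Submodule.subset_span ⟨1, rfl⟩
    fin_cases i
    · exact h0
    · have := add_mem h1 (Submodule.smul_mem _ r h0)
      rwa [sub_add_cancel] at this

lemma exists_orthogonal_basis_of_dvd (v : Basis (Fin 2) F V)
    {r : R} (hr : b (v 0) (v 1) = algebraMap R F r * b (v 0) (v 0)) :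
    ∃ v' : Basis (Fin 2) F V,
      Submodule.span R (Set.range v') = Submodule.span R (Set.range v) ∧
      b (v' 0) (v' 1) = 0 := by
  have hv : ![v 0, v 1] = v := by
    ext i
    fin_cases i <;> rfl
  have hs := span_pair_sub_smul (v 0) (v 1) r
  rw [hv] at hs
  obtain ⟨v', hv'⟩ := exists_basis_of_span_eq v _ hs
  refine ⟨v', by rw [hv', hs], ?_⟩
  rw [hv']
  simp only [Matrix.cons_val_zero, Matrix.cons_val_one, map_sub, hr]
  rw [← algebraMap_smul F r (v 0), map_smul, smul_eq_mul, sub_self]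

/-- One integral Gram-Schmidt step suffices if `b(v₀, v₁)` is a multiple of a diagonal Gram entry.
Otherwise both diagonal entries lie in `ϖ b(v₀, v₁) R`, and the determinant is `-b(v₀, v₁)²(1 -
ϖ²rs)`, which `hN` excludes. -/
lemma IsFormOf.exists_orthogonal_basis (hϖ : Irreducible ϖ) (h2 : (2 : F) ≠ 0)
    (hinv : IsOrthogonalInvolution inv) (hb : IsFormOf e inv b)
    (hN : ∀ (s : F) (r : R), -(s ^ 2 * algebraMap R F (1 + ϖ ^ 2 * r)) ∉ involutionDisc inv)
    (v : Basis (Fin 2) F V) : ∃ v' : Basis (Fin 2) F V,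
      Submodule.span R (Set.range v') = Submodule.span R (Set.range v) ∧
      b (v' 0) (v' 1) = 0 := by
  have key : ∀ x : F, (∃ r : R, b (v 0) (v 1) = algebraMap R F r * x) ∨
      ∃ r : R, x = algebraMap R F (ϖ * r) * b (v 0) (v 1) := by
    intro x
    by_cases hx : x = 0
    · exact .inr ⟨0, by simp [hx]⟩
    · exact exists_eq_mul_or hϖ _ hx
  rcases key (b (v 0) (v 0)) with ⟨r, hr⟩ | ⟨r, hr⟩
  · exact exists_orthogonal_basis_of_dvd v hr
  rcases key (b (v 1) (v 1)) with ⟨s, hs⟩ | ⟨s, hs⟩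
  · rw [hb.symm] at hs
    obtain ⟨v', h1, h2⟩ := exists_orthogonal_basis_of_dvd (v.reindex (Equiv.swap 0 1)) (r := s)
      (by simpa using hs)
    exact ⟨v', h1.trans (span_range_swap v), h2⟩
  · refine absurd ((hb.mem_involutionDisc_iff v h2 hinv).mpr ⟨1, one_ne_zero, ?_⟩)
      (hN (b (v 0) (v 1)) (-(r * s)))
    rw [hr, hs]
    simp only [map_add, map_mul, map_neg, map_pow, map_one]
    ring

/-- An almost unimodular lattice has an adapted basis. -/
lemma IsFormOf.exists_isAdaptedBasis (hϖ : Irreducible ϖ) (h2 : (2 : F) ≠ 0)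
    (hinv : IsOrthogonalInvolution inv) (hb : IsFormOf e inv b)
    (hN : ∀ (s : F) (r : R), -(s ^ 2 * algebraMap R F (1 + ϖ ^ 2 * r)) ∉ involutionDisc inv)
    (hV : finrank F V = 2) {M : Submodule R V} (hM : Submodule.IsLattice F M)
    (hint : M ≤ b.dualSubmodule M) (hdual : ∀ w ∈ b.dualSubmodule M, ϖ • w ∈ M) :
    ∃ (ξ : R) (v : Basis (Fin 2) F V), M = Submodule.span R (Set.range v) ∧
      IsAdaptedBasis b ϖ ξ v := by
  obtain ⟨v₁, rfl⟩ := exists_basis_of_isLattice hV M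
  obtain ⟨v₂, hv₂, hort₂⟩ := hb.exists_orthogonal_basis hϖ h2 hinv hN v₁
  have hne : ∀ v : Basis (Fin 2) F V, b (v 0) (v 1) = 0 → b (v 0) (v 0) ≠ 0 := by
    intro v hv h0
    apply hb.gram_det_ne_zero v
    rw [hv, h0]
    ring
  obtain ⟨v, hv, hort, r, hr⟩ : ∃ v : Basis (Fin 2) F V,
      Submodule.span R (Set.range v) = Submodule.span R (Set.range v₁) ∧ b (v 0) (v 1) = 0 ∧
      ∃ r : R, b (v 1) (v 1) = algebraMap R F r * b (v 0) (v 0) := by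
    rcases exists_eq_mul_or (R := R) hϖ (b (v₂ 1) (v₂ 1)) (hne v₂ hort₂) with ⟨r, hr⟩ | ⟨r, hr⟩
    · exact ⟨v₂, hv₂, hort₂, r, hr⟩
    · refine ⟨v₂.reindex (Equiv.swap 0 1), (span_range_swap v₂).trans hv₂, ?_, ϖ * r, ?_⟩
      · simpa using (hb.symm _ _).trans hort₂
      · simpa using hr
  rw [← hv] at hint hdual ⊢
  have hD := hb.gram_det_ne_zero v
  have ha := hne v hort
  have hmem : ∀ i, v i ∈ Submodule.span R (Set.range v) := fun i => Submodule.subset_span ⟨i, rfl⟩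
  obtain ⟨a, ha'⟩ := Submodule.mem_one.mp (hint (hmem 0) (v 0) (hmem 0))
  have hd : b (v 1) (v 1) ≠ 0 := by
    intro h0
    rw [h0, hort] at hD
    simp at hD
  refine ⟨-r, v, rfl, hort, ha, by rw [hr, map_neg]; ring, ?_⟩
  refine isPrimitivelyAnisotropic_of_neg_mem hϖ hN ?_ ?_
  · rw [hb.mem_involutionDisc_iff v h2 hinv]
    refine ⟨(b (v 0) (v 0))⁻¹, inv_ne_zero ha, ?_⟩
    rw [hr, hort, map_neg]
    field_simp
    ring
  -- The vector `v₁ / b(v₁, v₁)` lies in the dual, so `ϖ / b(v₁, v₁)` is integral. As `b(v₁, v₁) = r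
  -- * a` with `a` integral, `ϖ² ∣ r` would give `ϖ² ∣ ϖ`.
  · rintro ⟨c, hc⟩
    have hw : (b (v 1) (v 1))⁻¹ • v 1 ∈ b.dualSubmodule (Submodule.span R (Set.range v)) := by
      intro y hy
      have h1 : b ((b (v 1) (v 1))⁻¹ • v 1) y = v.repr y 1 := by
        conv_lhs => rw [eq_repr_smul_add v y]
        simp only [map_add, map_smul, LinearMap.smul_apply, smul_eq_mul,
          hb.symm (v 1) (v 0), hort]
        field_simp
        ring
      rw [h1]
      exact Submodule.mem_one.mpr ((mem_span_range_iff v).mp hy 1)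
    obtain ⟨s, hs⟩ := (mem_span_range_iff v).mp (hdual _ hw) 1
    rw [← algebraMap_smul F ϖ, smul_smul, map_smul, Finsupp.smul_apply, v.repr_self,
      Finsupp.single_eq_same, smul_eq_mul, mul_one] at hs
    have h3 : algebraMap R F (s * (r * a)) = algebraMap R F ϖ := by
      rw [map_mul, map_mul, hs, ha', ← hr]
      field_simp
    have h4 := IsFractionRing.injective R F h3
    refine hϖ.not_isUnit (isUnit_of_dvd_one ⟨-(s * c * a), ?_⟩)
    apply mul_left_cancel₀ hϖ.ne_zero
    linear_combination -h4 - s * a * hc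

namespace IsAdaptedBasis

variable {v : Basis (Fin 2) F V}

lemma algebraMap_ne_zero (hv : IsAdaptedBasis b ϖ ξ v) (hϖ : Irreducible ϖ) :
    algebraMap R F ξ ≠ 0 := by
  rw [Ne, FaithfulSMul.algebraMap_eq_zero_iff]
  exact hv.aniso.ne_zero hϖ

lemma mem_involutionDisc_iff (hv : IsAdaptedBasis b ϖ ξ v) (h2 : (2 : F) ≠ 0)
    (hinv : IsOrthogonalInvolution inv) (hb : IsFormOf e inv b) {x : F} :
    x ∈ involutionDisc inv ↔ ∃ c : F, c ≠ 0 ∧ x = -(c ^ 2 * algebraMap R F ξ) := by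
  rw [hb.mem_involutionDisc_iff v h2 hinv, hv.ortho, hv.apply_one]
  have ha := hv.ne_zero
  constructor
  · rintro ⟨c, hc, rfl⟩
    exact ⟨c * b (v 0) (v 0), mul_ne_zero hc ha, by ring⟩
  · rintro ⟨c, hc, rfl⟩
    refine ⟨c / b (v 0) (v 0), div_ne_zero hc ha, ?_⟩
    field_simp
    ring

lemma apply_self (hv : IsAdaptedBasis b ϖ ξ v) (hb : IsFormOf e inv b) (w : V) :
    b w w = (v.repr w 0 ^ 2 - algebraMap R F ξ * v.repr w 1 ^ 2) * b (v 0) (v 0) := by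
  conv_lhs => rw [eq_repr_smul_add v w]
  simp only [map_add, LinearMap.add_apply, map_smul, LinearMap.smul_apply, smul_eq_mul,
    hb.symm (v 1) (v 0), hv.ortho, hv.apply_one]
  ring

lemma apply_basis_zero (hv : IsAdaptedBasis b ϖ ξ v) (hb : IsFormOf e inv b) (w : V) :
    b w (v 0) = v.repr w 0 * b (v 0) (v 0) := by
  conv_lhs => rw [eq_repr_smul_add v w]
  simp only [map_add, LinearMap.add_apply, map_smul, LinearMap.smul_apply, smul_eq_mul,
    hb.symm (v 1) (v 0), hv.ortho]
  ring

lemma apply_basis_one (hv : IsAdaptedBasis b ϖ ξ v) (w : V) :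
    b w (v 1) = -(algebraMap R F ξ * (v.repr w 1 * b (v 0) (v 0))) := by
  conv_lhs => rw [eq_repr_smul_add v w]
  simp only [map_add, LinearMap.add_apply, map_smul, LinearMap.smul_apply, smul_eq_mul, hv.ortho,
    hv.apply_one]
  ring

/-- Anisotropy makes every `w` with `b(w, w) ∈ b(v₀, v₀)R` have integral coordinates, so no larger
lattice has norm in this ideal. -/
lemma isMaximalLattice (hv : IsAdaptedBasis b ϖ ξ v) (hϖ : Irreducible ϖ) (hb : IsFormOf e inv b) :
    IsMaximalLattice b (Submodule.span R {b (v 0) (v 0)}) (Submodule.span R (Set.range v)) := by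
  refine ⟨isLattice_span_range v, ?_, ?_⟩
  · rw [latticeNorm, Submodule.span_le]
    rintro _ ⟨w, hw, rfl⟩
    rw [mem_span_range_iff] at hw
    obtain ⟨r, hr⟩ := hw 0
    obtain ⟨s, hs⟩ := hw 1
    rw [SetLike.mem_coe, Submodule.mem_span_singleton]
    refine ⟨r ^ 2 - ξ * s ^ 2, ?_⟩
    rw [hv.apply_self hb w, Algebra.smul_def, ← hr, ← hs]
    simp
  · intro L _ hle hn
    refine le_antisymm hle fun w hw => ?_
    obtain ⟨n, hn⟩ := Submodule.mem_span_singleton.mp (hn (Submodule.subset_span ⟨w, hw, rfl⟩))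
    rw [hv.apply_self hb w, Algebra.smul_def] at hn
    have := hv.aniso.mem_range_of_sq_sub hϖ ⟨n, mul_right_cancel₀ hv.ne_zero hn⟩
    rw [mem_span_range_iff, Fin.forall_fin_two]
    exact this

lemma mem_dualSubmodule_iff (hv : IsAdaptedBasis b ϖ ξ v) (hb : IsFormOf e inv b) {w : V} :
    w ∈ b.dualSubmodule (Submodule.span R (Set.range v)) ↔
      v.repr w 0 * b (v 0) (v 0) ∈ Set.range (algebraMap R F) ∧
      algebraMap R F ξ * (v.repr w 1 * b (v 0) (v 0)) ∈ Set.range (algebraMap R F) := by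
  rw [← hv.apply_basis_zero hb, ← neg_neg (algebraMap R F ξ * _), ← hv.apply_basis_one]
  constructor
  · intro h
    obtain ⟨r, hr⟩ := Submodule.mem_one.mp (h (v 0) (Submodule.subset_span ⟨0, rfl⟩))
    obtain ⟨s, hs⟩ := Submodule.mem_one.mp (h (v 1) (Submodule.subset_span ⟨1, rfl⟩))
    exact ⟨⟨r, hr⟩, ⟨-s, by rw [map_neg, hs]⟩⟩
  · rintro ⟨⟨r, hr⟩, ⟨s, hs⟩⟩ y hy
    rw [mem_span_range_iff] at hy
    obtain ⟨p, hp⟩ := hy 0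
    obtain ⟨q, hq⟩ := hy 1
    refine Submodule.mem_one.mpr ⟨p * r - q * s, ?_⟩
    conv_rhs => rw [eq_repr_smul_add v y]
    simp only [map_add, map_sub, map_mul, map_smul, smul_eq_mul, hp, hq, hr, hs]
    ring

lemma repr_apply_eq (e : H ≃ₐ[F] End F V) (v : Basis (Fin 2) F V) (x : H) (w : V) (i : Fin 2) :
    v.repr (e x w) i =
      matrixEquiv e v x i 0 * v.repr w 0 + matrixEquiv e v x i 1 * v.repr w 1 := by
  conv_lhs => rw [eq_repr_smul_add v w]
  simp only [map_add, map_smul, Finsupp.add_apply, Finsupp.smul_apply, smul_eq_mul,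
    matrixEquiv_apply]
  ring

/-- The intersection of the endomorphism rings of the lattice spanned by an adapted basis and of
its dual, in coordinates. -/
lemma mem_endOrder_inf_iff (hv : IsAdaptedBasis b ϖ ξ v) (hϖ : Irreducible ϖ)
    (hb : IsFormOf e inv b) {x : H} :
    x ∈ endOrder e (Submodule.span R (Set.range v)) ⊓
        endOrder e (b.dualSubmodule (Submodule.span R (Set.range v))) ↔
      (∀ i j, matrixEquiv e v x i j ∈ Set.range (algebraMap R F)) ∧
        ∃ r : R, matrixEquiv e v x 0 1 = algebraMap R F (ξ * r) := by
  have hξ := hv.algebraMap_ne_zero hϖ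
  have ha := hv.ne_zero
  rw [Algebra.mem_inf]
  constructor
  · rintro ⟨h1, h2⟩
    refine ⟨fun i j => ?_, ?_⟩
    · rw [matrixEquiv_apply]
      exact (mem_span_range_iff v).mp (h1 (v j) (Submodule.subset_span ⟨j, rfl⟩)) i
    -- This is a dual vector along `v₁`; the first coordinate of its image, scaled by `b(v₀, v₀)`,
    -- is the upper right entry divided by `ξ`.
    · have hw : (algebraMap R F ξ * b (v 0) (v 0))⁻¹ • v 1 ∈
          b.dualSubmodule (Submodule.span R (Set.range v)) := by
        rw [hv.mem_dualSubmodule_iff hb]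
        refine ⟨⟨0, by simp⟩, ⟨1, ?_⟩⟩
        simp only [map_smul, Basis.repr_self, Finsupp.smul_apply, Finsupp.single_eq_same,
          smul_eq_mul, mul_one, map_one]
        field_simp
      obtain ⟨⟨r, hr⟩, -⟩ := (hv.mem_dualSubmodule_iff hb).mp (h2 _ hw)
      refine ⟨r, ?_⟩
      rw [map_mul, hr, map_smul, map_smul, Finsupp.smul_apply, matrixEquiv_apply, smul_eq_mul]
      field_simp
  · rintro ⟨h, q, hq⟩
    obtain ⟨p, hp⟩ := h 0 0
    obtain ⟨r, hr⟩ := h 1 0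
    obtain ⟨s, hs⟩ := h 1 1
    refine ⟨fun w hw => ?_, fun w hw => ?_⟩
    · rw [mem_span_range_iff] at hw ⊢
      obtain ⟨y, hy⟩ := hw 0
      obtain ⟨z, hz⟩ := hw 1
      rw [Fin.forall_fin_two, repr_apply_eq, repr_apply_eq]
      refine ⟨⟨p * y + ξ * q * z, ?_⟩, ⟨r * y + s * z, ?_⟩⟩
      · rw [hq, ← hp, ← hy, ← hz]
        simp
      · rw [← hr, ← hs, ← hy, ← hz]
        simp
    · rw [hv.mem_dualSubmodule_iff hb] at hw ⊢
      obtain ⟨⟨y, hy⟩, ⟨z, hz⟩⟩ := hw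
      rw [repr_apply_eq, repr_apply_eq]
      refine ⟨⟨p * y + q * z, ?_⟩, ⟨ξ * r * y + s * z, ?_⟩⟩
      · rw [hq, ← hp]
        simp only [map_add, map_mul, hy, hz]
        ring
      · rw [← hr, ← hs]
        simp only [map_add, map_mul, hy, hz]
        ring

/-- The adjoint involution in the coordinates of an adapted basis. -/
lemma matrixEquiv_inv (hv : IsAdaptedBasis b ϖ ξ v) (hϖ : Irreducible ϖ) (hb : IsFormOf e inv b)
    (x : H) : matrixEquiv e v (inv x) =
      !![matrixEquiv e v x 0 0, -(algebraMap R F ξ * matrixEquiv e v x 1 0);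
        -((algebraMap R F ξ)⁻¹ * matrixEquiv e v x 0 1), matrixEquiv e v x 1 1] := by
  have hξ := hv.algebraMap_ne_zero hϖ
  have ha := hv.ne_zero
  have h0 : ∀ j, matrixEquiv e v (inv x) 0 j * b (v 0) (v 0) = b (e x (v 0)) (v j) := by
    intro j
    rw [matrixEquiv_apply, ← hv.apply_basis_zero hb, ← hb.adjoint, hb.symm]
  have h1 : ∀ j, -(algebraMap R F ξ * (matrixEquiv e v (inv x) 1 j * b (v 0) (v 0))) =
      b (e x (v 1)) (v j) := by
    intro j
    rw [matrixEquiv_apply, ← hv.apply_basis_one, ← hb.adjoint, hb.symm]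
  have h00 := h0 0
  have h01 := h0 1
  have h10 := h1 0
  have h11 := h1 1
  rw [hv.apply_basis_zero hb (e x _), ← matrixEquiv_apply] at h00 h10
  rw [hv.apply_basis_one (e x _), ← matrixEquiv_apply] at h01 h11
  ext i j
  fin_cases i <;> fin_cases j <;>
    simp only [Fin.zero_eta, Fin.mk_one, Matrix.of_apply, Matrix.cons_val', Matrix.cons_val_zero,
      Matrix.cons_val_one, Matrix.cons_val_fin_one]
  · exact mul_right_cancel₀ ha h00
  · exact mul_right_cancel₀ ha (by rw [h01]; ring)
  · refine mul_left_cancel₀ hξ (mul_right_cancel₀ ha ?_)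
    rw [mul_neg, mul_inv_cancel_left₀ hξ]
    linear_combination -h10
  · refine mul_left_cancel₀ hξ (mul_right_cancel₀ ha ?_)
    linear_combination -h11

end IsAdaptedBasis

end Adapted

/-! ### Classification and discriminant of the maximal orders -/

section Orders

variable {R F H V : Type*} [CommRing R] [IsDomain R] [IsDiscreteValuationRing R] [Field F]
  [Algebra R F] [IsFractionRing R F] {ϖ ξ ξ' : R}
  [Ring H] [Algebra F H] [Algebra R H] [IsScalarTower R F H]
  [AddCommGroup V] [Module F V] [Module R V] [IsScalarTower R F V]
  {e : H ≃ₐ[F] End F V} {inv : H →ₗ[F] H} {b : LinearMap.BilinForm F V}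
  {v v' : Basis (Fin 2) F V}

lemma isInvOrder_of_forall_mem {O : Subalgebra R H} (hO : IsOrder (F := F) O)
    (hinv : ∀ x, inv (inv x) = x) (h : ∀ x ∈ O, inv x ∈ O) : IsInvOrder inv O := by
  refine ⟨hO, Set.Subset.antisymm ?_ fun x hx => ⟨inv x, h x hx, hinv x⟩⟩
  rintro _ ⟨x, hx, rfl⟩
  exact h x hx

/-- The order of matrices over `R` whose upper right entry is divisible by `ξ`, as a span. -/
lemma IsAdaptedBasis.toSubmodule_endOrder_inf (hv : IsAdaptedBasis b ϖ ξ v) (hϖ : Irreducible ϖ)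
    (hb : IsFormOf e inv b) :
    Subalgebra.toSubmodule (endOrder e (Submodule.span R (Set.range v)) ⊓
        endOrder e (b.dualSubmodule (Submodule.span R (Set.range v)))) =
      Submodule.span R (Set.range fun k => (matrixEquiv e v).symm
        (![!![1, 0; 0, 0], !![0, algebraMap R F ξ; 0, 0], !![0, 0; 1, 0], !![0, 0; 0, 1]] k)) := by
  apply le_antisymm
  · intro x hx
    obtain ⟨h, q, hq⟩ := (hv.mem_endOrder_inf_iff hϖ hb).mp hx
    obtain ⟨p, hp⟩ := h 0 0
    obtain ⟨r, hr⟩ := h 1 0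
    obtain ⟨s, hs⟩ := h 1 1
    rw [Submodule.mem_span_range_iff_exists_fun]
    refine ⟨![p, q, r, s], (matrixEquiv e v).injective ?_⟩
    simp only [Fin.sum_univ_four, ← algebraMap_smul F (_ : R) (_ : H), map_add, map_smul,
      AlgEquiv.apply_symm_apply]
    ext i j
    fin_cases i <;> fin_cases j <;> simp [hp, hq, hr, hs]
    rw [Algebra.smul_def, mul_comm]
  · rw [Submodule.span_le]
    rintro _ ⟨k, rfl⟩
    refine (hv.mem_endOrder_inf_iff hϖ hb).mpr ?_
    rw [AlgEquiv.apply_symm_apply]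
    fin_cases k
    · refine ⟨fun i j => ?_, 0, by simp⟩
      fin_cases i <;> fin_cases j
      exacts [⟨1, by simp⟩, ⟨0, by simp⟩, ⟨0, by simp⟩, ⟨0, by simp⟩]
    · refine ⟨fun i j => ?_, 1, by simp⟩
      fin_cases i <;> fin_cases j
      exacts [⟨0, by simp⟩, ⟨ξ, by simp⟩, ⟨0, by simp⟩, ⟨0, by simp⟩]
    · refine ⟨fun i j => ?_, 0, by simp⟩
      fin_cases i <;> fin_cases j
      exacts [⟨0, by simp⟩, ⟨0, by simp⟩, ⟨1, by simp⟩, ⟨0, by simp⟩]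
    · refine ⟨fun i j => ?_, 0, by simp⟩
      fin_cases i <;> fin_cases j
      exacts [⟨0, by simp⟩, ⟨0, by simp⟩, ⟨0, by simp⟩, ⟨1, by simp⟩]

/-- The involution fixes the diagonal and sends the off-diagonal pair `(ξq, r)` to `(-ξr, -q)`. -/
lemma IsAdaptedBasis.isInvOrder (hv : IsAdaptedBasis b ϖ ξ v) (hϖ : Irreducible ϖ)
    (hinv : IsOrthogonalInvolution inv) (hb : IsFormOf e inv b) :
    IsInvOrder inv (endOrder e (Submodule.span R (Set.range v)) ⊓
        endOrder e (b.dualSubmodule (Submodule.span R (Set.range v)))) := by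
  have hξ := hv.algebraMap_ne_zero hϖ
  refine isInvOrder_of_forall_mem ⟨?_, ?_⟩ hinv.involutive ?_
  · rw [hv.toSubmodule_endOrder_inf hϖ hb]
    exact Submodule.fg_span (Set.finite_range _)
  · rw [hv.toSubmodule_endOrder_inf hϖ hb, Submodule.span_span_of_tower, eq_top_iff]
    intro x _
    rw [Submodule.mem_span_range_iff_exists_fun]
    refine ⟨![matrixEquiv e v x 0 0, matrixEquiv e v x 0 1 / algebraMap R F ξ,
      matrixEquiv e v x 1 0, matrixEquiv e v x 1 1], (matrixEquiv e v).injective ?_⟩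
    simp only [Fin.sum_univ_four, map_add, map_smul, AlgEquiv.apply_symm_apply]
    ext i j
    fin_cases i <;> fin_cases j <;> simp [hξ]
  · intro x hx
    rw [hv.mem_endOrder_inf_iff hϖ hb] at hx ⊢
    obtain ⟨h, q, hq⟩ := hx
    obtain ⟨r, hr⟩ := h 1 0
    rw [hv.matrixEquiv_inv hϖ hb]
    refine ⟨fun i j => ?_, -r, by simp [hr]⟩
    fin_cases i <;> fin_cases j
    exacts [h 0 0, ⟨-(ξ * r), by simp [hr]⟩, ⟨-q, by simp [hq, hξ]⟩, h 1 1]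

/-- Every maximal order with involution comes from a lattice with an adapted basis. -/
theorem IsFormOf.exists_isAdaptedBasis_of_isMaximalInvOrder (hϖ : Irreducible ϖ)
    (h2 : (2 : F) ≠ 0) (hinv : IsOrthogonalInvolution inv) (hb : IsFormOf e inv b)
    (hN : ∀ (s : F) (r : R), -(s ^ 2 * algebraMap R F (1 + ϖ ^ 2 * r)) ∉ involutionDisc inv)
    (hV : finrank F V = 2) {O : Subalgebra R H} (hO : IsMaximalInvOrder inv O) :
    ∃ (ξ : R) (v : Basis (Fin 2) F V), IsAdaptedBasis b ϖ ξ v ∧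
      O = endOrder e (Submodule.span R (Set.range v)) ⊓
        endOrder e (b.dualSubmodule (Submodule.span R (Set.range v))) := by
  have hOinv : ∀ x ∈ O, inv x ∈ O := fun x hx => by
    have : inv x ∈ inv '' (O : Set H) := ⟨x, hx, rfl⟩
    rwa [hO.prop.2] at this
  obtain ⟨M, hM, hst, hint, hdual⟩ := hb.exists_stable_almost_unimodular_lattice hϖ hV
    hinv.involutive hO.prop.1 hOinv
  obtain ⟨ξ, v, rfl, hv⟩ := hb.exists_isAdaptedBasis hϖ h2 hinv hN hV hM hint hdual
  refine ⟨ξ, v, hv, hO.eq_of_le (hv.isInvOrder hϖ hinv hb) ?_⟩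
  exact fun x hx => ⟨hst x hx,
    hb.dualSubmodule_stable (hinv.involutive x) (hst _ (hOinv x hx))⟩

/-- Orders attached to two adapted bases are conjugate by an automorphism that commutes with the
involution. -/
theorem IsAdaptedBasis.exists_algEquiv (hv : IsAdaptedBasis b ϖ ξ v)
    (hv' : IsAdaptedBasis b ϖ ξ' v') (hϖ : Irreducible ϖ) (h2 : (2 : F) ≠ 0)
    (hinv : IsOrthogonalInvolution inv) (hb : IsFormOf e inv b) :
    ∃ φ : H ≃ₐ[F] H, (∀ x : H, φ (inv x) = inv (φ x)) ∧
      φ '' (endOrder e (Submodule.span R (Set.range v)) ⊓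
        endOrder e (b.dualSubmodule (Submodule.span R (Set.range v))) : Subalgebra R H) =
      (endOrder e (Submodule.span R (Set.range v')) ⊓
        endOrder e (b.dualSubmodule (Submodule.span R (Set.range v'))) : Subalgebra R H) := by
  have hξ := hv.algebraMap_ne_zero hϖ
  obtain ⟨c, hc, hcξ⟩ := (hv.mem_involutionDisc_iff h2 hinv hb).mp
    ((hv'.mem_involutionDisc_iff h2 hinv hb (x := -algebraMap R F ξ')).mpr
      ⟨1, one_ne_zero, by ring⟩)
  rw [neg_inj] at hcξ
  obtain ⟨u, hu⟩ := hv.aniso.exists_unit_of_eq_sq_mul hv'.aniso hϖ hc hcξ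
  have hu0 : algebraMap R F u ≠ 0 := hu ▸ hc
  have hui : algebraMap R F (u⁻¹ : Rˣ) = (algebraMap R F u)⁻¹ := by
    refine eq_inv_of_mul_eq_one_left ?_
    rw [← map_mul, Units.inv_mul, map_one]
  -- As `ξ' = u²ξ` with `u` a unit, dividing the second basis vector by `u` keeps the lattice and
  -- changes the parameter from `ξ'` to `ξ`.
  have hspan : Submodule.span R (Set.range ![v' 0, (u⁻¹ : Rˣ) • v' 1]) =
      Submodule.span R (Set.range v') := by
    apply le_antisymm <;> rw [Submodule.span_le] <;> rintro _ ⟨i, rfl⟩ <;> fin_cases i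
    · exact Submodule.subset_span ⟨0, rfl⟩
    · exact Submodule.smul_mem _ ((u⁻¹ : Rˣ) : R) (Submodule.subset_span ⟨1, rfl⟩)
    · exact Submodule.subset_span ⟨0, rfl⟩
    · have : (u : R) • (u⁻¹ : Rˣ) • v' 1 = v' 1 := smul_inv_smul u (v' 1)
      have hmem : (u⁻¹ : Rˣ) • v' 1 ∈
          Submodule.span R (Set.range ![v' 0, (u⁻¹ : Rˣ) • v' 1]) :=
        Submodule.subset_span ⟨1, rfl⟩
      have hu' := Submodule.smul_mem _ (u : R) hmem
      rwa [this] at hu'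
  obtain ⟨w, hw⟩ := exists_basis_of_span_eq v' _ hspan
  have hw0 : w 0 = v' 0 := by rw [hw]; rfl
  have hw1 : w 1 = (algebraMap R F u)⁻¹ • v' 1 := by
    rw [hw, ← hui, algebraMap_smul]
    rfl
  have hwa : IsAdaptedBasis b ϖ ξ w := by
    refine ⟨?_, ?_, ?_, hv.aniso⟩
    · rw [hw0, hw1, map_smul, hv'.ortho, smul_zero]
    · rw [hw0]
      exact hv'.ne_zero
    · rw [hw0, hw1, map_smul, map_smul, LinearMap.smul_apply, hv'.apply_one, hcξ, hu]
      simp only [smul_eq_mul]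
      field_simp
  rw [← hspan, ← hw]
  -- Matching matrices in `v` and `w` suffices: order and involution have the same coordinate
  -- formulas in both bases. The values `b(v₀, v₀)` and `b(w₀, w₀)` may differ, but they do not
  -- enter these formulas.
  let φ : H ≃ₐ[F] H := (matrixEquiv e v).trans (matrixEquiv e w).symm
  have hφ : ∀ x, matrixEquiv e w (φ x) = matrixEquiv e v x := fun x => by simp [φ]
  have hmem : ∀ x, φ x ∈ endOrder e (Submodule.span R (Set.range w)) ⊓
        endOrder e (b.dualSubmodule (Submodule.span R (Set.range w))) ↔
      x ∈ endOrder e (Submodule.span R (Set.range v)) ⊓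
        endOrder e (b.dualSubmodule (Submodule.span R (Set.range v))) := by
    intro x
    rw [hwa.mem_endOrder_inf_iff hϖ hb, hv.mem_endOrder_inf_iff hϖ hb, hφ]
  refine ⟨φ, fun x => (matrixEquiv e w).injective ?_, Set.Subset.antisymm ?_ ?_⟩
  · rw [hφ, hv.matrixEquiv_inv hϖ hb, hwa.matrixEquiv_inv hϖ hb, hφ]
  · rintro _ ⟨x, hx, rfl⟩
    exact (hmem x).mpr hx
  · intro y hy
    obtain ⟨x, rfl⟩ := φ.surjective y
    exact ⟨x, (hmem x).mp hy, rfl⟩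

/-- The elements of `disc` are `-c²ξ` with `c ≠ 0`; by anisotropy such an element is integral only
if `c` is. -/
lemma IsAdaptedBasis.iotaIdeal_eq (hv : IsAdaptedBasis b ϖ ξ v) (hϖ : Irreducible ϖ)
    (h2 : (2 : F) ≠ 0) (hinv : IsOrthogonalInvolution inv) (hb : IsFormOf e inv b) :
    iotaIdeal R (involutionDisc inv) = Submodule.span R {algebraMap R F ξ} := by
  apply le_antisymm
  · rw [iotaIdeal, Submodule.span_le]
    rintro _ ⟨hx, n, rfl⟩
    obtain ⟨c, -, hcn⟩ := (hv.mem_involutionDisc_iff h2 hinv hb).mp hx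
    obtain ⟨r, rfl⟩ := hv.aniso.mem_range_of_eq_sq_mul (ξ' := -n) (t := c) hϖ
      (by rw [map_neg, hcn, neg_neg])
    rw [hcn, SetLike.mem_coe, Submodule.mem_span_singleton]
    exact ⟨-r ^ 2, by rw [Algebra.smul_def]; simp⟩
  · rw [Submodule.span_singleton_le_iff_mem, ← Submodule.neg_mem_iff]
    refine Submodule.subset_span ⟨?_, -ξ, map_neg _ _⟩
    exact (hv.mem_involutionDisc_iff h2 hinv hb).mpr ⟨1, one_ne_zero, by ring⟩

lemma algebraDisc_eq_one (e : H ≃ₐ[F] End F V) (v : Basis (Fin 2) F V) :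
    algebraDisc R F H = 1 := by
  refine if_neg fun h => ?_
  let x : H := (matrixEquiv e v).symm !![0, 1; 0, 0]
  have hx : matrixEquiv e v x = !![0, 1; 0, 0] := AlgEquiv.apply_symm_apply _ _
  have hne : ∀ y : H, matrixEquiv e v y = !![0, 1; 0, 0] → y ≠ 0 := by
    rintro y hy rfl
    have := congrFun (congrFun hy 0) 1
    simp at this
  have hsq : x * x = 0 := by
    apply (matrixEquiv e v).injective
    rw [map_mul, hx, map_zero]
    ext i j
    fin_cases i <;> fin_cases j <;> simp
  exact hne x hx ((h x (hne x hx)).mul_right_eq_zero.mp hsq)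

/-- The reduced discriminant of the order attached to an adapted basis. -/
theorem IsAdaptedBasis.hasDiscriminant (hv : IsAdaptedBasis b ϖ ξ v) (hϖ : Irreducible ϖ)
    (h2 : (2 : F) ≠ 0) (hb : IsFormOf e inv b) :
    HasDiscriminant F (endOrder e (Submodule.span R (Set.range v)) ⊓
        endOrder e (b.dualSubmodule (Submodule.span R (Set.range v))))
      (Submodule.span R {algebraMap R F ξ}) := by
  have htr : ∀ x y : H, reducedTrace F (x * y) =
      matrixEquiv e v x 0 0 * matrixEquiv e v y 0 0 +
        matrixEquiv e v x 0 1 * matrixEquiv e v y 1 0 +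
        (matrixEquiv e v x 1 0 * matrixEquiv e v y 0 1 +
        matrixEquiv e v x 1 1 * matrixEquiv e v y 1 1) := by
    intro x y
    rw [reducedTrace_eq e v h2, map_mul, Matrix.mul_apply, Matrix.mul_apply, Fin.sum_univ_two,
      Fin.sum_univ_two]
  rw [HasDiscriminant, pow_two, Submodule.span_mul_span, Set.singleton_mul_singleton]
  apply le_antisymm
  · rw [Submodule.span_singleton_le_iff_mem, ← Submodule.neg_mem_iff]
    refine Submodule.subset_span ⟨fun k => (matrixEquiv e v).symm
        (![!![1, 0; 0, 0], !![0, algebraMap R F ξ; 0, 0], !![0, 0; 1, 0], !![0, 0; 0, 1]] k),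
        fun i => ?_, ?_⟩
    · rw [← Subalgebra.mem_toSubmodule, hv.toSubmodule_endOrder_inf hϖ hb]
      exact Submodule.subset_span ⟨i, rfl⟩
    · simp only [htr, AlgEquiv.apply_symm_apply]
      simp [Matrix.det_succ_row_zero, Fin.sum_univ_succ, Fin.succAbove]
  · rw [Submodule.span_le]
    rintro _ ⟨x, hx, rfl⟩
    choose h q hq using fun i => (hv.mem_endOrder_inf_iff hϖ hb).mp (hx i)
    choose m hm using h
    -- `G` is the trace form on the standard `R`-basis of the order and `C` holds the coordinates of
    -- the four elements, so the determinant is `-ξ² det(C)²`.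
    let C : Matrix (Fin 4) (Fin 4) R := Matrix.of fun i => ![m i 0 0, q i, m i 1 0, m i 1 1]
    let G : Matrix (Fin 4) (Fin 4) R := !![1, 0, 0, 0; 0, 0, ξ, 0; 0, ξ, 0, 0; 0, 0, 0, 1]
    have hG : G.det = -(ξ * ξ) := by
      simp [G, Matrix.det_succ_row_zero, Fin.sum_univ_succ, Fin.succAbove]
    have hC : (Matrix.of fun i j => reducedTrace F (x i * x j)) =
        (algebraMap R F).mapMatrix (C * G * C.transpose) := by
      ext i j
      simp only [Matrix.of_apply, htr, hq, ← hm, RingHom.mapMatrix_apply, Matrix.map_apply,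
        Matrix.mul_apply, Fin.sum_univ_four, C, G, Matrix.transpose_apply]
      simp
      ring
    rw [hC, ← RingHom.map_det, Matrix.det_mul, Matrix.det_mul, Matrix.det_transpose, hG,
      SetLike.mem_coe, Submodule.mem_span_singleton]
    refine ⟨-C.det ^ 2, ?_⟩
    rw [Algebra.smul_def]
    simp only [map_mul, map_neg, map_pow]
    ring

end Orders

end QuatInvolution

/-! ### Assembly of the theorem -/

theorem mainTheorem4
    -- `F` is a dyadic local field: nonarchimedean, of characteristic not two, with `2` in `𝔭`
    {F : Type*} [Field F] [ValuativeRel F] [TopologicalSpace F] [IsNonarchimedeanLocalField F]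
    (h2 : (2 : F) ≠ 0) (hdyadic : (2 : 𝒪[F]) ∈ 𝓂[F])
    -- `H` is a split quaternion algebra over `F`, identified with `End(V)`
    {H : Type*} [Ring H] [Algebra F H]
    {V : Type*} [AddCommGroup V] [Module F V] (hV : Module.finrank F V = 2)
    (e : H ≃ₐ[F] Module.End F V)
    (inv : H →ₗ[F] H) (hinv : QuatInvolution.IsOrthogonalInvolution inv)
    (hdefect : QuatInvolution.quadraticDefectSet 𝒪[F]
      ({ξ : F | -ξ ∈ QuatInvolution.involutionDisc inv} ∩ Set.range (algebraMap 𝒪[F] F)) =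
        IsLocalization.coeSubmodule F 𝓂[F]) :
    -- the form associated with the involution exists, and for each choice of it every maximal
    -- order with involution comes from a maximal lattice
    (∃ b : LinearMap.BilinForm F V, QuatInvolution.IsFormOf e inv b) ∧
    (∀ b : LinearMap.BilinForm F V, QuatInvolution.IsFormOf e inv b →
      ∀ O : Subalgebra 𝒪[F] H, QuatInvolution.IsMaximalInvOrder inv O →
        ∃ 𝔞 : FractionalIdeal (nonZeroDivisors 𝒪[F]) F, 𝔞 ≠ 0 ∧
          ∃ L : Submodule 𝒪[F] V, QuatInvolution.IsMaximalLattice b (𝔞 : Submodule 𝒪[F] F) L ∧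
            O = QuatInvolution.endOrder e L ⊓
              QuatInvolution.endOrder e (b.dualSubmodule L)) ∧
    -- all maximal orders with involution are isomorphic
    (∀ O O' : Subalgebra 𝒪[F] H, QuatInvolution.IsMaximalInvOrder inv O →
      QuatInvolution.IsMaximalInvOrder inv O' →
        ∃ φ : H ≃ₐ[F] H, (∀ x : H, φ (inv x) = inv (φ x)) ∧
          φ '' (O : Set H) = (O' : Set H)) ∧
    -- their discriminant
    (∀ O : Subalgebra 𝒪[F] H, QuatInvolution.IsMaximalInvOrder inv O →
      QuatInvolution.HasDiscriminant F O
        (QuatInvolution.algebraDisc 𝒪[F] F H ⊓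
          QuatInvolution.iotaIdeal 𝒪[F] (QuatInvolution.involutionDisc inv))) := by
  obtain ⟨ϖ, hϖ⟩ := IsDiscreteValuationRing.exists_irreducible 𝒪[F]
  obtain ⟨b₀, hb₀⟩ := hinv.exists_isFormOf h2 hV e
  have : FiniteDimensional F V := .of_finrank_pos (by omega)
  let v₀ := Module.finBasisOfFinrankEq F V hV
  -- The discriminant is a single square class, being the class of one Gram determinant.
  have hN := QuatInvolution.notMem_of_quadraticDefectSet_eq hϖ
    (D := QuatInvolution.involutionDisc inv) (fun x hx y hy => by
      obtain ⟨c, hc, rfl⟩ := (hb₀.mem_involutionDisc_iff v₀ h2 hinv).mp hx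
      obtain ⟨d, hd, rfl⟩ := (hb₀.mem_involutionDisc_iff v₀ h2 hinv).mp hy
      refine ⟨c / d, ?_⟩
      field_simp) hdefect
  refine ⟨⟨b₀, hb₀⟩, fun b hb O hO => ?_, fun O O' hO hO' => ?_, fun O hO => ?_⟩
  · obtain ⟨ξ, v, hv, hOv⟩ :=
      hb.exists_isAdaptedBasis_of_isMaximalInvOrder hϖ h2 hinv hN hV hO
    refine ⟨FractionalIdeal.spanSingleton _ (b (v 0) (v 0)), ?_, _, ?_, hOv⟩
    · rw [Ne, FractionalIdeal.spanSingleton_eq_zero_iff]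
      exact hv.ne_zero
    · rw [FractionalIdeal.coe_spanSingleton]
      exact hv.isMaximalLattice hϖ hb
  · obtain ⟨ξ, v, hv, rfl⟩ :=
      hb₀.exists_isAdaptedBasis_of_isMaximalInvOrder hϖ h2 hinv hN hV hO
    obtain ⟨ξ', v', hv', rfl⟩ :=
      hb₀.exists_isAdaptedBasis_of_isMaximalInvOrder hϖ h2 hinv hN hV hO'
    exact hv.exists_algEquiv hv' hϖ h2 hinv hb₀
  · obtain ⟨ξ, v, hv, rfl⟩ :=
      hb₀.exists_isAdaptedBasis_of_isMaximalInvOrder hϖ h2 hinv hN hV hO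
    rw [QuatInvolution.algebraDisc_eq_one e v, hv.iotaIdeal_eq hϖ h2 hinv hb₀,
      inf_eq_right.mpr ((Submodule.span_singleton_le_iff_mem _ _).mpr
        (Submodule.mem_one.mpr ⟨ξ, rfl⟩))]
    exact hv.hasDiscriminant hϖ h2 hb₀
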